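/- **Theorem.** Let $X=[0,1)\times\mathbb Z/2$ with the probability measure $\mu=m\otimes h$, where $m$ is Lebesgue measure on $[0,1)$ and $h=\tfrac12\delta_0+\tfrac12\delta_1$. Let $T:[0,1)\to[0,1)$ be the dyadic odometer, which translates $[1-2^{-n},1-2^{-n-1})$ onto $[2^{-n-1},2^{-n})$ for $n=0,1,2,\dots$. Let $\varphi:[0,1)\to\mathbb Z/2$ be equal to $0$ on $[1-2^{-n},\,1-2^{-n}+2^{-n-2})$ and to $1$ on $[1-2^{-n}+2^{-n-2},\,1-2^{-n-1})$, $n=0,1,2,\dots$. The Mathew–Nadkarni transformation is $T_\varphi:X\to X$, $T_\varphi(x,g)=(Tx,\varphi(x)+g)$. For $\alpha\in(0,1]$, a measure-preserving transformation $S$ of a probability space $(Y,\mathcal B,\nu)$, invertible modulo null sets, is called $\alpha$-rigid if there are integers $n_1<n_2<\cdots$ tending to $+\infty$ such that for every $A\in\mathcal B$ the limit $\lim_k\nu(S^{n_k}A\cap A)$ exists and is at least $\alpha\,\nu(A)$. Write $U_Sf=f\circ S^{-1}$ for the associated unitary operator on $L^2(Y,\nu)$. The spectral measure $\sigma_f$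 of $f\in L^2(Y,\nu)$ is the finite measure on the circle with $\hat\sigma_f(n)=\langle U_S^nf,f\rangle$ for all $n\in\mathbb Z$, and the cyclic space of $f$ is the closed span of $\{U_S^nf:n\in\mathbb Z\}$. The reduced maximal spectral type of $S$ is the smallest class of measures, with respect to absolute continuity, that dominates $\sigma_f$ for all $f\in L^2(Y,\nu)$ with $\int f\,d\nu=0$. The spectrum of $S$ is singular if its reduced maximal spectral type is singular to Lebesgue measure. Then $T_\varphi$ preserves $\mu$, is invertible modulo null sets, and the following hold. 1. $T_\varphi$ is $\tfrac12$-rigid. 2. The spectrum of $T_\varphi$ consists of a Lebesgue component of multiplicity $2$ together with a discrete component: the orthogonal complement in $L^2(X,\mu)$ of the closed span of the eigenfunctions of $U_{T_\varphi}$ is the orthogonal sum of two cyclic spaces, each generated by a function whose spectral measure is equivalent to Lebesgue measure. The reduced maximal spectral type of $T_\varphi$ exists and is not singular; that is, the spectrum of $T_\varphi$ is not singular. 3. Consequently, for every $\alpha\in(0,\tfrac12]$ it is not true that every $\alpha$-rigid invertible measure-preserving transformation of a standard Borel probability space has singular spectrum. -/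

import Mathlib

open MeasureTheory Filter Topology

noncomputable section

namespace MathewNadkarni

/-! ### Rigidity -/

/-- `T` is `α`-rigid on the probability space `(X, μ)`: `α ∈ (0, 1]` and along one sequence of
times tending to infinity, chosen before the set `A`, the limit of `μ (T^{n_k} A ∩ A)` exists
and is at least `α * μ A`, for every measurable `A`. -/
def IsAlphaRigid {X : Type*} [MeasurableSpace X] (T : X → X) (μ : Measure X) (α : ℝ) : Prop :=
  0 < α ∧ α ≤ 1 ∧ ∃ n : ℕ → ℕ, StrictMono n ∧ ∀ A : Set X, MeasurableSet A →
    ∃ l : ℝ, Tendsto (fun k => μ.real ((T^[n k] '' A) ∩ A)) atTop (𝓝 l) ∧ α * μ.real A ≤ l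

/-! ### Spectral theory of a unitary operator -/

section Spectral

variable {H : Type*} [NormedAddCommGroup H] [InnerProductSpace ℂ H]

/-- `σ` is the spectral measure of `f` for the unitary operator `U`: the finite Borel measure on
the circle `ℝ / ℤ` with `∫ exp (2 π i n t) dσ(t) = ⟨U ^ n f, f⟩` for all integers `n` (Mathlib's
inner product is linear in its second argument). -/
def IsSpectralMeasure (U : H ≃ₗᵢ[ℂ] H) (f : H) (σ : Measure UnitAddCircle) : Prop :=
  IsFiniteMeasure σ ∧ ∀ n : ℤ, ∫ t, (fourier n t : ℂ) ∂σ = inner ℂ f ((U ^ n) f)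

/-- The cyclic space of `h`: the closed linear span of `U ^ n h`, `n ∈ ℤ`. -/
def cyclicSpace (U : H ≃ₗᵢ[ℂ] H) (h : H) : Submodule ℂ H :=
  (Submodule.span ℂ (Set.range fun n : ℤ => (U ^ n) h)).topologicalClosure

/-- The discrete part of `U`: the closed linear span of its eigenvectors. -/
def discretePart (U : H ≃ₗᵢ[ℂ] H) : Submodule ℂ H :=
  (Submodule.span ℂ {f : H | ∃ c : ℂ, U f = c • f}).topologicalClosure

/-- On the closed subspace `K` the operator `U` has Lebesgue spectrum of multiplicity `m`:
`K` is the Hilbert sum of `m` pairwise orthogonal cyclic spaces, each generated by a vector whose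
spectral measure is equivalent to Lebesgue measure. -/
def HasLebesgueSpectrumOn (U : H ≃ₗᵢ[ℂ] H) (K : Submodule ℂ H) (m : ℕ) : Prop :=
  ∃ f : Fin m → H,
    (∀ i, ∃ σ : Measure UnitAddCircle, IsSpectralMeasure U (f i) σ ∧
      σ ≪ (volume : Measure UnitAddCircle) ∧ (volume : Measure UnitAddCircle) ≪ σ) ∧
    (∀ i j, i ≠ j → cyclicSpace U (f i) ⟂ cyclicSpace U (f j)) ∧
    (⨆ i, cyclicSpace U (f i)).topologicalClosure = K

end Spectral

/-! ### Spectral theory of a measure-preserving transformation -/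

section Koopman

variable {X : Type*} [MeasurableSpace X] {μ : Measure X}

/-- `U` is the operator `f ↦ f ∘ T⁻¹` on `L²(X, μ)`, that is, `(U f) (T x) = f x` for almost
every `x`; that `U` is a unitary operator expresses that `T` is invertible modulo null sets. -/
def IsKoopman (T : X → X) (U : Lp ℂ 2 μ ≃ₗᵢ[ℂ] Lp ℂ 2 μ) : Prop :=
  ∀ f : Lp ℂ 2 μ, ∀ᵐ x ∂μ, U f (T x) = f x

/-- `σ` is a representative of the reduced maximal spectral type, the smallest class
(for `≪`) that dominates the spectral measures of all `f ∈ L²(X, μ)` of mean zero. -/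
def IsReducedMaximalSpectralType (U : Lp ℂ 2 μ ≃ₗᵢ[ℂ] Lp ℂ 2 μ)
    (σ : Measure UnitAddCircle) : Prop :=
  IsFiniteMeasure σ ∧
  (∀ f : Lp ℂ 2 μ, ∫ x, f x ∂μ = 0 → ∀ ρ, IsSpectralMeasure U f ρ → ρ ≪ σ) ∧
  ∀ ν : Measure UnitAddCircle,
    (∀ f : Lp ℂ 2 μ, ∫ x, f x ∂μ = 0 → ∀ ρ, IsSpectralMeasure U f ρ → ρ ≪ ν) → σ ≪ ν

/-- The spectrum is singular: the reduced maximal spectral type is singular with respect to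
Lebesgue measure. -/
def HasSingularSpectrum (U : Lp ℂ 2 μ ≃ₗᵢ[ℂ] Lp ℂ 2 μ) : Prop :=
  ∃ σ : Measure UnitAddCircle, IsReducedMaximalSpectralType U σ ∧
    σ ⟂ₘ (volume : Measure UnitAddCircle)

end Koopman

/-- Every `α`-rigid invertible measure-preserving transformation of a standard probability space
has singular spectrum. -/
def RigidityForcesSingularSpectrum (α : ℝ) : Prop :=
  ∀ (X : Type) [MeasurableSpace X] [StandardBorelSpace X] (μ : Measure X)
    [IsProbabilityMeasure μ] (T : X → X) (U : Lp ℂ 2 μ ≃ₗᵢ[ℂ] Lp ℂ 2 μ),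
    MeasurePreserving T μ μ → IsKoopman T U → IsAlphaRigid T μ α → HasSingularSpectrum U

/-! ### The Mathew-Nadkarni transformation -/

/-- The half-open interval `[0, 1)`. -/
abbrev I01 : Type := Set.Ico (0 : ℝ) 1

/-- The index `n` of the interval `[1 - 1/2^n, 1 - 1/2^(n+1))` that contains `x`. -/
def level (x : I01) : ℕ := sInf {n : ℕ | (x : ℝ) < 1 - 1 / 2 ^ (n + 1)}

theorem level_mem (x : I01) :
    (x : ℝ) ∈ Set.Ico (1 - 1 / 2 ^ level x : ℝ) (1 - 1 / 2 ^ (level x + 1)) := by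
  obtain ⟨x, hx0, hx1⟩ := x
  have hne : {n : ℕ | x < 1 - 1 / 2 ^ (n + 1)}.Nonempty := by
    obtain ⟨n, hn⟩ := exists_pow_lt_of_lt_one (sub_pos.2 hx1) (by norm_num : (1 / 2 : ℝ) < 1)
    refine ⟨n, ?_⟩
    have h2 : (1 / 2 : ℝ) ^ (n + 1) ≤ (1 / 2) ^ n :=
      pow_le_pow_of_le_one (by norm_num) (by norm_num) (Nat.le_succ n)
    simp only [Set.mem_ofPred_eq]
    rw [← one_div_pow]
    linarith
  refine ⟨?_, Nat.sInf_mem hne⟩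
  rcases Nat.eq_zero_or_pos (level ⟨x, hx0, hx1⟩) with h | h
  · rw [h]; simpa using hx0
  · have h3 := Nat.notMem_of_lt_sInf (Nat.sub_lt h Nat.one_pos)
    simp only [Set.mem_ofPred_eq, not_lt] at h3
    change 1 - 1 / 2 ^ (level ⟨x, hx0, hx1⟩ - 1 + 1) ≤ x at h3
    rwa [Nat.sub_add_cancel h] at h3

/-- The dyadic odometer (von Neumann-Kakutani adding machine) on `[0, 1)`: it translates
`[1 - 1/2^n, 1 - 1/2^(n+1))` onto `[1/2^(n+1), 1/2^n)`, `n = 0, 1, 2, …`. -/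
def odometer (x : I01) : I01 :=
  ⟨(x : ℝ) - (1 - 1 / 2 ^ level x) + 1 / 2 ^ (level x + 1), by
    obtain ⟨h1, h2⟩ := level_mem x
    have h3 : (1 : ℝ) / 2 ^ level x ≤ 1 := by
      rw [div_le_one (by positivity)]; exact one_le_pow₀ (by norm_num)
    have h4 : (0 : ℝ) < 1 / 2 ^ (level x + 1) := by positivity
    constructor <;> linarith⟩

/-- The cocycle: `0` on `[1 - 1/2^n, 1 - 1/2^n + 1/2^(n+2))` and `1` on
`[1 - 1/2^n + 1/2^(n+2), 1 - 1/2^(n+1))`, `n = 0, 1, 2, …`. -/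
def cocycle (x : I01) : ZMod 2 :=
  if (x : ℝ) < 1 - 1 / 2 ^ level x + 1 / 2 ^ (level x + 2) then 0 else 1

/-- The Mathew-Nadkarni transformation `(x, g) ↦ (T x, φ x + g)` of `[0, 1) × ℤ/2`. -/
def transformation (p : I01 × ZMod 2) : I01 × ZMod 2 :=
  (odometer p.1, cocycle p.1 + p.2)

/-- Haar probability measure `½ δ₀ + ½ δ₁` on `ℤ/2`. -/
def haarZ2 : Measure (ZMod 2) :=
  (1 / 2 : ENNReal) • Measure.dirac 0 + (1 / 2 : ENNReal) • Measure.dirac 1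

/-- The product of Lebesgue measure on `[0, 1)` and Haar measure on `ℤ/2`. -/
def mnMeasure : Measure (I01 × ZMod 2) :=
  (Measure.comap ((↑) : I01 → ℝ) volume).prod haarZ2

end MathewNadkarni

end

noncomputable section

namespace MathewNadkarni

/-! Everything rests on self-similarity. The odometer carries the lower half of `[0, 1)` to the
upper half, and the upper half back to the lower half by a scaled copy of itself. The cocycle
respects this: on the upper half it is a scaled copy of itself, on the lower half it reads the next
binary digit. For the Koopman operator `U`, the composition `C` with the fibre translation by the
first digit, the fibre flip `J` and the restrictions `R₀`, `R₁` to the halves, this says `R₀ U = U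
R₁` and `R₁ U = C R₀`. Hence `U²` restricts to `U C` and `C U` on the two halves. Moreover `C U = U
C J`, so `C` and `U` anticommute on odd vectors (`J f = -f`), while `C` is the identity on even ones
(`J f = f`). These relations are abstracted in `SelfSimilarUnitary`, and the spectral argument uses
nothing else.

Odd part: let `F` be the nontrivial character of the fibre. Up to sign and a swap of `F` with `C F`,
the powers of `U C` and `C U` act on these two vectors as powers of `U`. Restriction to the halves
therefore expresses the correlations of `F` with `U ^ k F` and `U ^ k (C F)` through correlations at
about half the time, and strong induction makes all translates of `F` and `C F` orthonormal
(`inner_gen_gen`). Each spectral measure is then Lebesgue measure.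

Even part: the vectors `cyl w` are periodic under powers of `U` with period a power of two, so they
are finite sums of eigenvectors (`mem_span_eigenvectors`). A vector orthogonal to all `cyl w` and to
all translates of the generators keeps this property under `R₀` and `R₁`, so it vanishes
(`eq_zero_of_perp`). Eigenvectors are orthogonal to vectors with orthonormal translates, and
`hasLebesgueSpectrumOn` follows.

Rigidity: along the times `2 ^ k`, `U` is eventually the identity on each `cyl w` and tends weakly
to `0` on the generators, so it tends weakly to `(1 + J) / 2` (`tendsto_inner_pow`). On an indicator
function this leaves at least half of the measure.

Maximal spectral type: a weighted sum of the spectral measures of a countable total family in the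
complement of the constants. Its domination property (`absolutelyContinuous_of_total`) comes from
approximating indicators by trigonometric polynomials. -/

/-- The Hilbert space skeleton of the transformation: a unitary operator `U` which is self-similar
with respect to the two "restriction" operators `R₀`, `R₁`. -/
structure SelfSimilarUnitary (H : Type*) [NormedAddCommGroup H] [InnerProductSpace ℂ H] where
  U : H ≃ₗᵢ[ℂ] H
  C : H ≃ₗᵢ[ℂ] H
  J : H ≃ₗᵢ[ℂ] H
  R₀ : H →L[ℂ] H
  R₁ : H →L[ℂ] H
  e : H
  F : H
  R₀_U : ∀ f, R₀ (U f) = U (R₁ f)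
  R₁_U : ∀ f, R₁ (U f) = C (R₀ f)
  C_U : ∀ f, C (U f) = U (C (J f))
  C_C : ∀ f, C (C f) = f
  J_J : ∀ f, J (J f) = f
  J_U : ∀ f, J (U f) = U (J f)
  J_C : ∀ f, J (C f) = C (J f)
  R₀_J : ∀ f, R₀ (J f) = J (R₀ f)
  R₁_J : ∀ f, R₁ (J f) = J (R₁ f)
  R₀_C : ∀ f, R₀ (C f) = R₀ f
  R₁_C : ∀ f, R₁ (C f) = R₁ (J f)
  C_of_J : ∀ f, J f = f → C f = f
  inner_eq : ∀ f g : H, inner ℂ f g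
    = (1 / 2 : ℂ) * (inner ℂ (R₀ f) (R₀ g) + inner ℂ (R₁ f) (R₁ g))
  R₀_F : R₀ F = F
  R₁_F : R₁ F = F
  J_F : J F = -F
  norm_F : ‖F‖ = 1
  J_e : J e = e
  U_e : U e = e
  norm_e : ‖e‖ = 1
  -- A completeness axiom without reference to cylinders: in the concrete model, orthogonality to
  -- `e` and `F` after every composition of restrictions means that all integrals over cylinders in
  -- each fibre vanish.
  eq_zero : ∀ K : Set H, (∀ h ∈ K, R₀ h ∈ K) → (∀ h ∈ K, R₁ h ∈ K) →
    (∀ h ∈ K, inner ℂ e h = 0) → (∀ h ∈ K, inner ℂ F h = 0) → ∀ h ∈ K, h = 0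

/-! ### Powers of unitary operators and equality up to sign -/

section Generic

variable {H : Type*} [NormedAddCommGroup H] [InnerProductSpace ℂ H]

theorem isometryEquiv_mul_apply (A B : H ≃ₗᵢ[ℂ] H) (f : H) : (A * B) f = A (B f) := rfl

theorem zpow_intertwine {R : H →L[ℂ] H} {A B : H ≃ₗᵢ[ℂ] H} (h : ∀ f, R (A f) = B (R f))
    (n : ℤ) (f : H) : R ((A ^ n) f) = (B ^ n) (R f) := by
  induction n generalizing f with
  | zero => simp
  | succ n ih =>
    rw [zpow_add_one, zpow_add_one, isometryEquiv_mul_apply, isometryEquiv_mul_apply,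
      ih, h]
  | pred n ih =>
    rw [zpow_sub_one, zpow_sub_one, isometryEquiv_mul_apply, isometryEquiv_mul_apply,
      ih]
    congr 1
    apply B.injective
    rw [← h, ← isometryEquiv_mul_apply, ← isometryEquiv_mul_apply]
    simp

theorem inner_zpow_zpow (U : H ≃ₗᵢ[ℂ] H) (m n : ℤ) (f g : H) :
    inner ℂ ((U ^ m) f) ((U ^ n) g) = inner ℂ f ((U ^ (n - m)) g) := by
  rw [← LinearIsometryEquiv.inner_map_map (U ^ m) f ((U ^ (n - m)) g),
    ← isometryEquiv_mul_apply, ← zpow_add]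
  congr 3
  ring_nf

theorem inner_involution {A : H ≃ₗᵢ[ℂ] H} (h : ∀ f, A (A f) = f) (f g : H) :
    inner ℂ (A f) g = inner ℂ f (A g) := by
  rw [← LinearIsometryEquiv.inner_map_map A (A f) g, h]

/-- Equality up to sign. -/
def EqSign {H : Type*} [AddGroup H] (x y : H) : Prop := x = y ∨ x = -y

namespace EqSign

theorem refl {H : Type*} [AddGroup H] (x : H) : EqSign x x := Or.inl rfl

theorem symm {H : Type*} [AddGroup H] {x y : H} (h : EqSign x y) : EqSign y x := by
  rcases h with h | h
  · exact Or.inl h.symm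
  · exact Or.inr (by rw [h, neg_neg])

theorem trans {H : Type*} [AddGroup H] {x y z : H} (h : EqSign x y) (h' : EqSign y z) :
    EqSign x z := by
  rcases h with rfl | rfl <;> rcases h' with rfl | rfl
  · exact Or.inl rfl
  · exact Or.inr rfl
  · exact Or.inr rfl
  · exact Or.inl (neg_neg _)

theorem map {x y : H} (A : H ≃ₗᵢ[ℂ] H) (h : EqSign x y) : EqSign (A x) (A y) := by
  rcases h with rfl | rfl
  · exact Or.inl rfl
  · exact Or.inr (map_neg A y)

theorem inner_zero {x y : H} (h : EqSign x y) {a : H} (ha : inner ℂ y a = 0) :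
    inner ℂ x a = 0 := by
  rcases h with rfl | rfl
  · exact ha
  · rw [inner_neg_left, ha, neg_zero]

theorem inner_zero_right {x y : H} (h : EqSign x y) {a : H} (ha : inner ℂ a y = 0) :
    inner ℂ a x = 0 := by
  rcases h with rfl | rfl
  · exact ha
  · rw [inner_neg_right, ha, neg_zero]

theorem norm_inner_right {x y : H} (h : EqSign x y) (a : H) :
    ‖inner ℂ a x‖ = ‖inner ℂ a y‖ := by
  rcases h with rfl | rfl
  · rfl
  · rw [inner_neg_right, norm_neg]

end EqSign

end Generic

/-! ### Orthonormality and propagation of orthogonality for the two generators -/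

namespace SelfSimilarUnitary

variable {H : Type*} [NormedAddCommGroup H] [InnerProductSpace ℂ H] (S : SelfSimilarUnitary H)

/-- The two generators of the Lebesgue component. -/
def gen (p : Fin 2) : H := if p = 0 then S.F else S.C S.F

theorem gen_zero : S.gen 0 = S.F := by simp [gen]

theorem gen_one : S.gen 1 = S.C S.F := by simp [gen]

theorem C_gen (p : Fin 2) : S.C (S.gen p) = S.gen (1 - p) := by
  fin_cases p
  · simp [gen]
  · simp [gen, S.C_C]

theorem J_gen (p : Fin 2) : S.J (S.gen p) = -S.gen p := by
  fin_cases p <;> simp [gen, S.J_C, S.J_F]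

theorem R₀_gen (p : Fin 2) : S.R₀ (S.gen p) = S.F := by
  fin_cases p <;> simp [gen, S.R₀_C, S.R₀_F]

theorem R₁_gen (p : Fin 2) : EqSign (S.R₁ (S.gen p)) S.F := by
  fin_cases p
  · exact Or.inl (by simp [gen, S.R₁_F])
  · exact Or.inr (by simp [gen, S.R₁_C, S.J_F, S.R₁_F])

theorem R₁_gen_one : S.R₁ (S.gen 1) = -S.F := by
  simp [gen, S.R₁_C, S.J_F, S.R₁_F]

theorem J_zpow (n : ℤ) (f : H) : S.J ((S.U ^ n) f) = (S.U ^ n) (S.J f) :=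
  zpow_intertwine (R := (S.J.toContinuousLinearEquiv : H →L[ℂ] H)) (A := S.U) (B := S.U) S.J_U n f

/-- On odd vectors `C U = -U C`, and `U` preserves oddness, so moving `C` past `n` factors only
costs a sign. -/
theorem C_zpow {f : H} (hf : S.J f = -f) (n : ℤ) :
    EqSign (S.C ((S.U ^ n) f)) ((S.U ^ n) (S.C f)) := by
  have key : ∀ f, S.J f = -f → EqSign (S.C (S.U f)) (S.U (S.C f)) := fun f hf =>
    Or.inr (by rw [S.C_U, hf, map_neg, map_neg])
  induction n generalizing f with
  | zero => exact EqSign.refl _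
  | succ n ih =>
    rw [zpow_add_one, isometryEquiv_mul_apply, isometryEquiv_mul_apply]
    have hU : S.J (S.U f) = -(S.U f) := by rw [S.J_U, hf, map_neg]
    exact (ih hU).trans ((key f hf).map _)
  | pred n ih =>
    rw [zpow_sub_one, isometryEquiv_mul_apply, isometryEquiv_mul_apply]
    have hU : S.J (S.U⁻¹ f) = -(S.U⁻¹ f) := by
      have := S.J_zpow (-1) f
      rw [hf, map_neg] at this
      simpa using this
    refine (ih hU).trans (EqSign.map _ ?_)
    have := (key _ hU).map S.U⁻¹
    rw [← isometryEquiv_mul_apply S.U S.U⁻¹, ← isometryEquiv_mul_apply S.U⁻¹ S.U]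
      at this
    simpa using this.symm

/-- Collecting all factors `C` on the right costs signs only, and each of them swaps the two
generators. Thus the generator index shifts by the parity of `n`, the same for both, and the two
images again involve both generators. -/
theorem UC_zpow (n : ℤ) (p : Fin 2) :
    ∃ q, EqSign (((S.U * S.C) ^ n) (S.gen p)) ((S.U ^ n) (S.gen q)) ∧
      EqSign (((S.U * S.C) ^ n) (S.gen (1 - p))) ((S.U ^ n) (S.gen (1 - q))) := by
  suffices ∀ n : ℤ, ∃ a : Fin 2, ∀ p, EqSign (((S.U * S.C) ^ n) (S.gen p))
      ((S.U ^ n) (S.gen (p + a))) by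
    obtain ⟨a, ha⟩ := this n
    refine ⟨p + a, ha p, ?_⟩
    have := ha (1 - p)
    have h2 : 1 - p + a = 1 - (p + a) := by clear this ha; revert p a; decide
    rwa [h2] at this
  intro n
  have hC : S.C⁻¹ = S.C := by
    ext f
    apply S.C.injective
    rw [S.C_C, ← isometryEquiv_mul_apply]; simp
  have h2 : ∀ p a : Fin 2, 1 - (p + a) = p + (a + 1) := by decide
  induction n with
  | zero => exact ⟨0, fun p => by simpa using EqSign.refl _⟩
  | succ n ih =>
    obtain ⟨a, ha⟩ := ih
    refine ⟨a + 1, fun p => ?_⟩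
    rw [add_comm (n : ℤ) 1, zpow_one_add, zpow_one_add, isometryEquiv_mul_apply,
      isometryEquiv_mul_apply, isometryEquiv_mul_apply, ← h2, ← S.C_gen]
    exact (((ha p).map S.C).trans (S.C_zpow (S.J_gen _) n)).map S.U
  | pred n ih =>
    obtain ⟨a, ha⟩ := ih
    refine ⟨a + 1, fun p => ?_⟩
    rw [sub_eq_add_neg, add_comm (-(n : ℤ)) (-1), zpow_add, zpow_add,
      isometryEquiv_mul_apply, zpow_neg_one, mul_inv_rev,
      isometryEquiv_mul_apply, hC, ← h2, ← S.C_gen, zpow_neg_one]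
    have := ((ha p).map (S.U⁻¹)).map S.C
    refine this.trans ?_
    rw [← isometryEquiv_mul_apply S.U⁻¹, ← zpow_neg_one, ← zpow_add]
    exact S.C_zpow (S.J_gen _) _

/-- `C U` is the conjugate of `U C` by `C`, which swaps the generators. -/
theorem CU_zpow (n : ℤ) (p : Fin 2) :
    ∃ q, EqSign (((S.C * S.U) ^ n) (S.gen p)) ((S.U ^ n) (S.gen q)) ∧
      EqSign (((S.C * S.U) ^ n) (S.gen (1 - p))) ((S.U ^ n) (S.gen (1 - q))) := by
  have h : ∀ f, S.C ((S.U * S.C) f) = (S.C * S.U) (S.C f) := fun f => rfl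
  have h2 : ∀ p, ((S.C * S.U) ^ n) (S.gen p) = S.C (((S.U * S.C) ^ n) (S.gen (1 - p))) := by
    intro p
    have := zpow_intertwine (R := (S.C.toContinuousLinearEquiv : H →L[ℂ] H)) h n (S.gen (1 - p))
    refine Eq.symm (this.trans ?_)
    congr 1
    change S.C (S.gen (1 - p)) = _
    rw [C_gen, sub_sub_cancel]
  obtain ⟨q, hq1, hq2⟩ := S.UC_zpow n p
  refine ⟨q, ?_, ?_⟩
  · rw [h2]
    refine (hq2.map S.C).trans ((S.C_zpow (S.J_gen _) n).trans ?_)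
    rw [C_gen, sub_sub_cancel]
    exact EqSign.refl _
  · rw [h2, sub_sub_cancel]
    refine (hq1.map S.C).trans ((S.C_zpow (S.J_gen _) n).trans ?_)
    rw [C_gen]
    exact EqSign.refl _

theorem R₀_even (n : ℤ) (f : H) : S.R₀ ((S.U ^ (2 * n)) f) = ((S.U * S.C) ^ n) (S.R₀ f) := by
  rw [zpow_mul]
  refine zpow_intertwine (fun f => ?_) n f
  change S.R₀ (S.U (S.U f)) = S.U (S.C (S.R₀ f))
  rw [S.R₀_U, S.R₁_U]

theorem R₁_even (n : ℤ) (f : H) : S.R₁ ((S.U ^ (2 * n)) f) = ((S.C * S.U) ^ n) (S.R₁ f) := by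
  rw [zpow_mul]
  refine zpow_intertwine (fun f => ?_) n f
  change S.R₁ (S.U (S.U f)) = S.C (S.U (S.R₁ f))
  rw [S.R₁_U, S.R₀_U]

/-- The remaining factor `U` is written as `(U C) C`, whence the exponent `n + 1`. -/
theorem R₀_odd (n : ℤ) (f : H) :
    S.R₀ ((S.U ^ (2 * n + 1)) f) = ((S.U * S.C) ^ (n + 1)) (S.C (S.R₁ f)) := by
  rw [zpow_add_one, zpow_add_one, isometryEquiv_mul_apply, isometryEquiv_mul_apply, R₀_even,
    S.R₀_U, isometryEquiv_mul_apply, S.C_C]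

theorem R₁_odd (n : ℤ) (f : H) :
    S.R₁ ((S.U ^ (2 * n + 1)) f) = ((S.C * S.U) ^ n) (S.C (S.R₀ f)) := by
  rw [zpow_add_one, isometryEquiv_mul_apply, R₁_even, S.R₁_U]

/-- `C F` agrees with `F` on the lower half and with `-F` on the upper half. The sum and the
difference of the generators are therefore supported on one half each, which lets the halves be
tested separately. -/
theorem R₀_add : S.R₀ (S.gen 0 + S.gen 1) = S.F + S.F := by
  rw [map_add, R₀_gen, R₀_gen]

theorem R₁_add : S.R₁ (S.gen 0 + S.gen 1) = 0 := by
  rw [map_add, R₁_gen_one, gen_zero, S.R₁_F, add_neg_cancel]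

theorem R₀_sub : S.R₀ (S.gen 0 - S.gen 1) = 0 := by
  rw [map_sub, R₀_gen, R₀_gen, sub_self]

theorem R₁_sub : S.R₁ (S.gen 0 - S.gen 1) = S.F + S.F := by
  rw [map_sub, R₁_gen_one, gen_zero, S.R₁_F, sub_neg_eq_add]

/-- Being orthogonal to all translates of the two generators. -/
def PerpGen (h : H) : Prop := ∀ (n : ℤ) (p : Fin 2), inner ℂ ((S.U ^ n) (S.gen p)) h = 0

theorem fin_two_eq_or (p q : Fin 2) : p = q ∨ p = 1 - q := by revert p q; decide

variable {S}

/-- Even translates of the sum and odd translates of the difference vanish on the upper half. On the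
lower half they are twice the vectors `(U C) ^ n F` and `(U C) ^ (n + 1) (C F)`, which up to sign
exhaust the translates of both generators. -/
theorem PerpGen.map_R₀ {h : H} (hh : S.PerpGen h) : S.PerpGen (S.R₀ h) := by
  have key₀ : ∀ n : ℤ, inner ℂ (((S.U * S.C) ^ n) (S.gen 0)) (S.R₀ h) = 0 := by
    intro n
    have h1 : inner ℂ ((S.U ^ (2 * n)) (S.gen 0 + S.gen 1)) h = 0 := by
      rw [map_add, inner_add_left, hh, hh, add_zero]
    rw [S.inner_eq, S.R₀_even, S.R₁_even, R₀_add, R₁_add, map_zero, inner_zero_left, map_add,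
      inner_add_left] at h1
    rw [gen_zero]
    linear_combination h1
  have key₁ : ∀ n : ℤ, inner ℂ (((S.U * S.C) ^ (n + 1)) (S.gen 1)) (S.R₀ h) = 0 := by
    intro n
    have h1 : inner ℂ ((S.U ^ (2 * n + 1)) (S.gen 0 - S.gen 1)) h = 0 := by
      rw [map_sub, inner_sub_left, hh, hh, sub_zero]
    rw [S.inner_eq, S.R₀_odd, S.R₁_odd, R₀_sub, R₁_sub, map_zero, map_zero, inner_zero_left,
      map_add, map_add, inner_add_left] at h1
    rw [gen_one]
    linear_combination h1
  intro n p
  obtain ⟨q, h1, h2⟩ := S.UC_zpow n 0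
  rcases fin_two_eq_or p q with rfl | rfl
  · exact h1.symm.inner_zero (key₀ n)
  -- The shift to `n - 1` undoes the exponent `n + 1` of the odd case.
  · exact h2.symm.inner_zero (by simpa using key₁ (n - 1))

theorem PerpGen.map_R₁ {h : H} (hh : S.PerpGen h) : S.PerpGen (S.R₁ h) := by
  have key₀ : ∀ n : ℤ, inner ℂ (((S.C * S.U) ^ n) (S.gen 0)) (S.R₁ h) = 0 := by
    intro n
    have h1 : inner ℂ ((S.U ^ (2 * n)) (S.gen 0 - S.gen 1)) h = 0 := by
      rw [map_sub, inner_sub_left, hh, hh, sub_zero]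
    rw [S.inner_eq, S.R₀_even, S.R₁_even, R₀_sub, R₁_sub, map_zero, inner_zero_left, map_add,
      inner_add_left] at h1
    rw [gen_zero]
    linear_combination h1
  have key₁ : ∀ n : ℤ, inner ℂ (((S.C * S.U) ^ n) (S.gen 1)) (S.R₁ h) = 0 := by
    intro n
    have h1 : inner ℂ ((S.U ^ (2 * n + 1)) (S.gen 0 + S.gen 1)) h = 0 := by
      rw [map_add, inner_add_left, hh, hh, add_zero]
    rw [S.inner_eq, S.R₀_odd, S.R₁_odd, R₀_add, R₁_add, map_zero, map_zero, inner_zero_left,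
      map_add, map_add, inner_add_left] at h1
    rw [gen_one]
    linear_combination h1
  intro n p
  obtain ⟨q, h1, h2⟩ := S.CU_zpow n 0
  rcases fin_two_eq_or p q with rfl | rfl
  · exact h1.symm.inner_zero (key₀ n)
  · exact h2.symm.inner_zero (by simpa using key₁ n)

variable (S)

theorem UC_zpow_F (n : ℤ) (x : H) (hx : EqSign x (S.gen 0) ∨ EqSign x (S.gen 1)) :
    ∃ q, EqSign (((S.U * S.C) ^ n) x) ((S.U ^ n) (S.gen q)) := by
  rcases hx with hx | hx
  · obtain ⟨q, h, -⟩ := S.UC_zpow n 0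
    exact ⟨q, (hx.map _).trans h⟩
  · obtain ⟨q, h, -⟩ := S.UC_zpow n 1
    exact ⟨q, (hx.map _).trans h⟩

theorem CU_zpow_F (n : ℤ) (x : H) (hx : EqSign x (S.gen 0) ∨ EqSign x (S.gen 1)) :
    ∃ q, EqSign (((S.C * S.U) ^ n) x) ((S.U ^ n) (S.gen q)) := by
  rcases hx with hx | hx
  · obtain ⟨q, h, -⟩ := S.CU_zpow n 0
    exact ⟨q, (hx.map _).trans h⟩
  · obtain ⟨q, h, -⟩ := S.CU_zpow n 1
    exact ⟨q, (hx.map _).trans h⟩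

/-- The contributions of the two halves cancel. -/
theorem inner_F_gen_one : inner ℂ S.F (S.gen 1) = 0 := by
  rw [S.inner_eq, R₀_gen, R₁_gen_one, S.R₀_F, S.R₁_F, inner_neg_right, add_neg_cancel, mul_zero]

theorem inner_F_U_gen (p : Fin 2) : inner ℂ S.F (S.U (S.gen p)) = 0 := by
  -- The lower half reproduces the correlation of `F` with `U F` up to sign, and the upper half
  -- gives the correlation of `F` with `C F`, which is zero. For `p = 0` a number is then twice its
  -- own modulus.
  have h : ∀ p, 2 * ‖inner ℂ S.F (S.U (S.gen p))‖ = ‖inner ℂ S.F (S.U S.F)‖ := by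
    intro p
    rw [← ((S.R₁_gen p).map S.U).norm_inner_right, S.inner_eq, S.R₀_U, S.R₁_U, R₀_gen, S.R₀_F,
      S.R₁_F, ← gen_one, inner_F_gen_one]
    simp
  have h0 := h 0
  rw [gen_zero] at h0
  have h1 : ‖inner ℂ S.F (S.U S.F)‖ = 0 := by linarith
  have := h p
  rw [← norm_eq_zero]
  linarith

/-- Both halves turn a correlation at time `2 * j` into one at time `j`, and a correlation at time
`2 * j + 1` into ones at times `j + 1` and `j`. -/
theorem inner_F_pow_gen (k : ℕ) (p : Fin 2) (hk : k ≠ 0) :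
    inner ℂ S.F ((S.U ^ (k : ℤ)) (S.gen p)) = 0 := by
  induction k using Nat.strong_induction_on generalizing p with
  | _ k ih =>
    have hC : ∀ {x}, EqSign x S.F → EqSign (S.C x) (S.gen 1) := fun h => by
      rw [gen_one]; exact h.map S.C
    have hR : EqSign (S.R₁ (S.gen p)) (S.gen 0) := by rw [gen_zero]; exact S.R₁_gen p
    rcases Nat.even_or_odd' k with ⟨j, rfl | rfl⟩
    · have hj : j ≠ 0 := by omega
      rw [S.inner_eq, S.R₀_F, S.R₁_F]
      push_cast
      rw [R₀_even, R₁_even, R₀_gen]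
      obtain ⟨q, hq⟩ := S.UC_zpow_F j S.F (Or.inl (by rw [gen_zero]; exact EqSign.refl _))
      obtain ⟨r, hr⟩ := S.CU_zpow_F j (S.R₁ (S.gen p)) (Or.inl hR)
      rw [hq.inner_zero_right (ih j (by omega) q hj), hr.inner_zero_right (ih j (by omega) r hj)]
      simp
    -- At time `1` the recursion does not descend, since `j + 1 = 2 * j + 1`; this case was settled
    -- separately.
    · rcases Nat.eq_zero_or_pos j with rfl | hj
      · simpa using S.inner_F_U_gen p
      · rw [S.inner_eq, S.R₀_F, S.R₁_F]
        push_cast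
        rw [R₀_odd, R₁_odd, R₀_gen]
        obtain ⟨q, hq⟩ := S.UC_zpow_F (j + 1) _ (Or.inr (hC (S.R₁_gen p)))
        obtain ⟨r, hr⟩ := S.CU_zpow_F j _ (Or.inr (hC (EqSign.refl _)))
        rw [hr.inner_zero_right (ih j (by omega) r (by omega)), hq.inner_zero_right]
        · simp
        · exact_mod_cast ih (j + 1) (by omega) q (by omega)

theorem inner_gen_pow_gen (k : ℕ) (p q : Fin 2) (h : k ≠ 0 ∨ p ≠ q) :
    inner ℂ (S.gen p) ((S.U ^ (k : ℤ)) (S.gen q)) = 0 := by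
  have h0 : ∀ q, (k ≠ 0 ∨ q ≠ 0) → inner ℂ S.F ((S.U ^ (k : ℤ)) (S.gen q)) = 0 := by
    intro q hq
    by_cases hk : k = 0
    · have : q = 1 := by
        have := hq.resolve_left (not_not.2 hk)
        omega
      subst hk this
      simpa using S.inner_F_gen_one
    · exact S.inner_F_pow_gen k q hk
  by_cases hp : p = 0
  · subst hp
    rw [gen_zero]
    exact h0 q (by tauto)
  · have hp : p = 1 := by omega
    subst hp
    rw [gen_one, inner_involution S.C_C]
    refine (S.C_zpow (S.J_gen q) k).inner_zero_right ?_
    rw [C_gen]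
    have h1 : ∀ q : Fin 2, 1 ≠ q → 1 - q ≠ 0 := by decide
    exact h0 _ (h.imp_right (h1 q))

theorem norm_gen (p : Fin 2) : ‖S.gen p‖ = 1 := by
  fin_cases p <;> simp [gen, S.norm_F]

theorem inner_gen_gen (m n : ℤ) (p q : Fin 2) (h : m ≠ n ∨ p ≠ q) :
    inner ℂ ((S.U ^ m) (S.gen p)) ((S.U ^ n) (S.gen q)) = 0 := by
  rcases le_total m n with hmn | hmn
  · obtain ⟨k, hk⟩ := Int.eq_ofNat_of_zero_le (sub_nonneg.2 hmn)
    rw [inner_zpow_zpow, hk]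
    exact S.inner_gen_pow_gen k p q (h.imp_left fun h => by omega)
  · obtain ⟨k, hk⟩ := Int.eq_ofNat_of_zero_le (sub_nonneg.2 hmn)
    rw [inner_eq_zero_symm, inner_zpow_zpow, hk]
    exact S.inner_gen_pow_gen k q p (h.imp (fun h => by omega) Ne.symm)

theorem orthonormal_gen (p : Fin 2) : Orthonormal ℂ fun n : ℤ => (S.U ^ n) (S.gen p) :=
  ⟨fun n => by rw [LinearIsometryEquiv.norm_map, norm_gen],
    fun _ _ h => S.inner_gen_gen _ _ p p (Or.inl h)⟩

theorem inner_U_left (x y : H) : inner ℂ (S.U x) y = inner ℂ x (S.U⁻¹ y) := by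
  conv_lhs => rw [← LinearIsometryEquiv.inner_map_map S.U⁻¹, ← isometryEquiv_mul_apply]
  simp

/-! ### Cylinder vectors and their periodicity -/

section Discrete

variable [CompleteSpace H]

/-- The adjoint of the restriction operator `R₀` or `R₁`. -/
def ext (b : Bool) : H →L[ℂ] H :=
  ContinuousLinearMap.adjoint (if b then S.R₁ else S.R₀)

theorem inner_ext_false (x y : H) : inner ℂ (S.ext false x) y = inner ℂ x (S.R₀ y) := by
  simp [ext, ContinuousLinearMap.adjoint_inner_left]

theorem inner_ext_true (x y : H) : inner ℂ (S.ext true x) y = inner ℂ x (S.R₁ y) := by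
  simp [ext, ContinuousLinearMap.adjoint_inner_left]

/-- The adjoint form of `R₀_U`, with the adjoint of `U` equal to its inverse. -/
theorem U_ext_true (x : H) : S.U (S.ext true x) = S.ext false (S.U x) := by
  refine ext_inner_right ℂ fun y => ?_
  rw [inner_U_left, inner_ext_true, inner_ext_false]
  conv_rhs => rw [inner_U_left]
  congr 1
  apply S.U.injective
  rw [← S.R₀_U, ← isometryEquiv_mul_apply, ← isometryEquiv_mul_apply]
  simp

theorem U_ext_false (x : H) : S.U (S.ext false x) = S.ext true (S.C x) := by
  refine ext_inner_right ℂ fun y => ?_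
  rw [inner_U_left, inner_ext_true, inner_ext_false, inner_involution S.C_C]
  congr 1
  apply S.C.injective
  rw [← S.R₁_U, ← isometryEquiv_mul_apply, S.C_C]
  simp

theorem J_ext (b : Bool) (x : H) : S.J (S.ext b x) = S.ext b (S.J x) := by
  refine ext_inner_right ℂ fun y => ?_
  rw [inner_involution S.J_J]
  cases b
  · rw [inner_ext_false, inner_ext_false, S.R₀_J, inner_involution S.J_J]
  · rw [inner_ext_true, inner_ext_true, S.R₁_J, inner_involution S.J_J]

/-- On even vectors `C` is the identity, so both `U C` and `C U` reduce to `U`: the plain odometer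
appears, whose square is a copy of itself on each half. -/
theorem U_U_ext (b : Bool) {x : H} (hx : S.J x = x) :
    S.U (S.U (S.ext b x)) = S.ext b (S.U x) := by
  cases b
  · rw [U_ext_false, U_ext_true, S.C_of_J x hx]
  · rw [U_ext_true, U_ext_false, S.C_of_J (S.U x) (by rw [S.J_U, hx])]

theorem pow_ext (b : Bool) (n : ℕ) {x : H} (hx : S.J x = x) :
    (S.U ^ (2 * n)) (S.ext b x) = S.ext b ((S.U ^ n) x) := by
  induction n generalizing x with
  | zero => simp
  | succ n ih =>
    rw [mul_add_one, pow_add, pow_two, pow_succ, isometryEquiv_mul_apply, isometryEquiv_mul_apply,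
      isometryEquiv_mul_apply, U_U_ext S b hx, ih (by rw [S.J_U, hx])]

/-- The indicator functions of the cylinders, normalised. -/
def cyl : List Bool → H
  | [] => S.e
  | b :: w => S.ext b (cyl w)

theorem J_cyl (w : List Bool) : S.J (S.cyl w) = S.cyl w := by
  induction w with
  | nil => exact S.J_e
  | cons b w ih => rw [cyl, J_ext, ih]

theorem pow_cyl (w : List Bool) : (S.U ^ (2 ^ w.length)) (S.cyl w) = S.cyl w := by
  induction w with
  | nil => simpa [cyl] using S.U_e
  | cons b w ih => rw [List.length_cons, pow_succ', cyl, S.pow_ext b _ (S.J_cyl w), ih]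

/-- The vectors orthogonal to both families form a set stable under `R₀` and `R₁`: for cylinders by
adjunction, which lengthens the word by a letter, and for generators by `PerpGen.map_R₀` and
`PerpGen.map_R₁`. -/
theorem eq_zero_of_perp {h : H} (hw : ∀ w, inner ℂ (S.cyl w) h = 0) (hg : S.PerpGen h) :
    h = 0 := by
  refine S.eq_zero {h | (∀ w, inner ℂ (S.cyl w) h = 0) ∧ S.PerpGen h} ?_ ?_ ?_ ?_ h ⟨hw, hg⟩
  · rintro h ⟨hw, hg⟩
    exact ⟨fun w => by rw [← inner_ext_false]; exact hw (false :: w), hg.map_R₀⟩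
  · rintro h ⟨hw, hg⟩
    exact ⟨fun w => by rw [← inner_ext_true]; exact hw (true :: w), hg.map_R₁⟩
  · rintro h ⟨hw, hg⟩
    exact hw []
  · rintro h ⟨hw, hg⟩
    simpa [gen_zero] using hg 0 0

end Discrete

end SelfSimilarUnitary

/-! ### Spectral measures of periodic vectors and of vectors with orthonormal translates -/

section Spectral

variable {H : Type*} [NormedAddCommGroup H] [InnerProductSpace ℂ H]

theorem mem_cyclicSpace_orthogonal_iff {U : H ≃ₗᵢ[ℂ] H} {f x : H} :
    x ∈ (cyclicSpace U f)ᗮ ↔ ∀ n : ℤ, inner ℂ ((U ^ n) f) x = 0 := by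
  rw [cyclicSpace, Submodule.orthogonal_closure]
  refine ⟨fun h n => h _ (Submodule.subset_span ⟨n, rfl⟩), fun h u hu => ?_⟩
  induction hu using Submodule.span_induction with
  | mem y hy => obtain ⟨n, rfl⟩ := hy; exact h n
  | zero => exact inner_zero_left _
  | add y z _ _ hy hz => rw [inner_add_left, hy, hz, add_zero]
  | smul c y _ hy => rw [inner_smul_left, hy, mul_zero]

theorem zpow_mem_cyclicSpace (U : H ≃ₗᵢ[ℂ] H) (f : H) (n : ℤ) : (U ^ n) f ∈ cyclicSpace U f :=
  Submodule.le_topologicalClosure _ (Submodule.subset_span ⟨n, rfl⟩)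

/-- A vector on which `U ^ (2 * m)` acts as a unimodular scalar is the sum of two vectors on which
`U ^ m` acts as opposite unimodular scalars. -/
theorem exists_decomposition_of_pow_two_mul {U : H ≃ₗᵢ[ℂ] H} {m : ℕ} {u : H} {c : ℂ}
    (hc : ‖c‖ = 1) (hu : (U ^ (2 * m)) u = c • u) :
    ∃ (d : ℂ) (v w : H), ‖d‖ = 1 ∧ u = v + w ∧ (U ^ m) v = d • v ∧ (U ^ m) w = (-d) • w := by
  obtain ⟨d, hd⟩ := IsAlgClosed.exists_pow_nat_eq c zero_lt_two
  have hd1 : ‖d‖ = 1 := by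
    rw [← hd, norm_pow] at hc
    exact (pow_eq_one_iff_of_nonneg (norm_nonneg _) two_ne_zero).1 hc
  have hd0 : d ≠ 0 := by rintro rfl; simp at hd1
  have hu' : (U ^ m) ((U ^ m) u) = (d ^ 2) • u := by
    rw [hd, ← hu, two_mul, pow_add, isometryEquiv_mul_apply]
  -- With `d ^ 2 = c`, these are the projections of `u` to the eigenspaces of `U ^ m` for `d` and
  -- `-d`.
  refine ⟨d, (2 * d)⁻¹ • ((U ^ m) u + d • u), -((2 * d)⁻¹ • ((U ^ m) u - d • u)), hd1, ?_, ?_, ?_⟩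
  · have : (2 * d)⁻¹ • ((U ^ m) u + d • u) + -((2 * d)⁻¹ • ((U ^ m) u - d • u))
        = ((2 * d)⁻¹ * (2 * d)) • u := by module
    rw [this, inv_mul_cancel₀ (mul_ne_zero two_ne_zero hd0), one_smul]
  · rw [map_smul, map_add, map_smul, hu']
    module
  · rw [map_neg, map_smul, map_sub, map_smul, hu']
    module

theorem mem_span_eigenvectors {U : H ≃ₗᵢ[ℂ] H} {n : ℕ} {u : H} {c : ℂ} (hc : ‖c‖ = 1)
    (hu : (U ^ (2 ^ n)) u = c • u) : u ∈ Submodule.span ℂ {f : H | ∃ c : ℂ, U f = c • f} := by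
  induction n generalizing u c with
  | zero => exact Submodule.subset_span ⟨c, by simpa using hu⟩
  | succ n ih =>
    rw [pow_succ'] at hu
    obtain ⟨d, v, w, hd, rfl, hv, hw⟩ := exists_decomposition_of_pow_two_mul hc hu
    exact add_mem (ih hd hv) (ih (by rwa [norm_neg]) hw)

theorem integrable_fourier (σ : Measure UnitAddCircle) [IsFiniteMeasure σ] (n : ℤ) :
    Integrable (fun t : UnitAddCircle => (fourier n t : ℂ)) σ :=
  (BoundedContinuousFunction.mkOfCompact (fourier n)).integrable σ

theorem zpow_eigenvector {U : H ≃ₗᵢ[ℂ] H} {f : H} {c : ℂ} (hc : c ≠ 0) (h : U f = c • f) (n : ℤ) :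
    (U ^ n) f = c ^ n • f := by
  induction n with
  | zero => simp
  | succ n ih => rw [zpow_add_one, isometryEquiv_mul_apply, h, map_smul, ih, smul_smul,
      zpow_add_one₀ hc, mul_comm]
  | pred n ih =>
    have h1 : U⁻¹ f = c⁻¹ • f := by
      apply U.injective
      rw [← isometryEquiv_mul_apply, map_smul, h, smul_smul, inv_mul_cancel₀ hc]
      simp
    rw [zpow_sub_one, isometryEquiv_mul_apply, h1, map_smul, ih, smul_smul, zpow_sub_one₀ hc,
      mul_comm]

theorem exists_isSpectralMeasure_of_eigenvector {U : H ≃ₗᵢ[ℂ] H} {f : H} {c : ℂ} (hc : ‖c‖ = 1)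
    (h : U f = c • f) : ∃ σ, IsSpectralMeasure U f σ := by
  have hc0 : c ≠ 0 := by rintro rfl; simp at hc
  obtain ⟨t, ht⟩ : ∃ t : UnitAddCircle, (AddCircle.toCircle t : ℂ) = c := by
    obtain ⟨t, ht⟩ := (AddCircle.homeomorphCircle (T := 1) one_ne_zero).surjective
      ⟨c, mem_sphere_zero_iff_norm.2 hc⟩
    refine ⟨t, ?_⟩
    rw [AddCircle.homeomorphCircle_apply] at ht
    rw [ht]
  refine ⟨ENNReal.ofReal (‖f‖ ^ 2) • Measure.dirac t, ?_, fun n => ?_⟩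
  · exact (Measure.dirac t).smul_finite ENNReal.ofReal_ne_top
  · rw [integral_smul_measure, integral_dirac, zpow_eigenvector hc0 h, inner_smul_right,
      inner_self_eq_norm_sq_to_K, fourier_apply, AddCircle.toCircle_zsmul, Circle.coe_zpow, ht,
      ENNReal.toReal_ofReal (by positivity)]
    simp [mul_comm]

theorem IsSpectralMeasure.add {U : H ≃ₗᵢ[ℂ] H} {f g : H} {σ τ : Measure UnitAddCircle}
    (hf : IsSpectralMeasure U f σ) (hg : IsSpectralMeasure U g τ)
    (h : ∀ n : ℤ, inner ℂ f ((U ^ n) g) = 0) : IsSpectralMeasure U (f + g) (σ + τ) := by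
  obtain ⟨_, hf⟩ := hf
  obtain ⟨_, hg⟩ := hg
  refine ⟨inferInstance, fun n => ?_⟩
  have h' : inner ℂ g ((U ^ n) f) = 0 := by
    have := h (-n)
    rw [inner_eq_zero_symm] at this
    rw [← LinearIsometryEquiv.inner_map_map (U ^ n), ← isometryEquiv_mul_apply, ← zpow_add] at this
    simpa using this
  rw [integral_add_measure (integrable_fourier σ n) (integrable_fourier τ n), hf, hg, map_add,
    inner_add_left, inner_add_right, inner_add_right, h, h']
  simp

/-- Repeated splitting ends at eigenvectors, whose spectral measures are point masses. The pieces
contribute additively because their translates are orthogonal. -/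
theorem exists_isSpectralMeasure_of_pow {U : H ≃ₗᵢ[ℂ] H} {n : ℕ} {u : H} {c : ℂ} (hc : ‖c‖ = 1)
    (hu : (U ^ (2 ^ n)) u = c • u) : ∃ σ, IsSpectralMeasure U u σ := by
  induction n generalizing u c with
  | zero => exact exists_isSpectralMeasure_of_eigenvector hc (by simpa using hu)
  | succ n ih =>
    rw [pow_succ'] at hu
    obtain ⟨d, v, w, hd, rfl, hv, hw⟩ := exists_decomposition_of_pow_two_mul hc hu
    obtain ⟨σ, hσ⟩ := ih hd hv
    obtain ⟨τ, hτ⟩ := ih (c := -d) (by rwa [norm_neg]) hw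
    refine ⟨σ + τ, hσ.add hτ fun k => ?_⟩
    -- `U ^ 2 ^ n` acts by `d` on `v` and by `-d` on the translates of `w`, so by unitarity the
    -- inner product equals its own negative.
    have h1 : inner ℂ v ((U ^ k) w) = inner ℂ ((U ^ 2 ^ n) v) ((U ^ 2 ^ n) ((U ^ k) w)) :=
      (LinearIsometryEquiv.inner_map_map _ _ _).symm
    have h2 : (U ^ 2 ^ n) ((U ^ k) w) = (-d) • (U ^ k) w := by
      rw [← map_smul, ← hw, ← isometryEquiv_mul_apply, ← isometryEquiv_mul_apply, ← zpow_natCast,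
        ← zpow_add, ← zpow_add, add_comm]
    rw [hv, h2, inner_smul_left, inner_smul_right, ← mul_assoc, mul_neg,
      ← Complex.normSq_eq_conj_mul_self, Complex.normSq_eq_norm_sq, hd] at h1
    norm_num at h1
    linear_combination (1 / 2 : ℂ) * h1

theorem integral_fourier_volume (n : ℤ) :
    ∫ t : UnitAddCircle, (fourier n t : ℂ) = if n = 0 then 1 else 0 := by
  have h := (orthonormal_iff_ite.1 (orthonormal_fourier (T := 1))) 0 n
  rw [ContinuousMap.inner_toLp] at h
  rw [AddCircle.volume_eq_smul_haarAddCircle]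
  simpa [eq_comm] using h

theorem isSpectralMeasure_volume {U : H ≃ₗᵢ[ℂ] H} {f : H}
    (hf : Orthonormal ℂ fun n : ℤ => (U ^ n) f) :
    IsSpectralMeasure U f (volume : Measure UnitAddCircle) := by
  refine ⟨inferInstance, fun n => ?_⟩
  rw [integral_fourier_volume]
  simpa [eq_comm] using (orthonormal_iff_ite.1 hf 0 n).symm

/-- A vector whose translates are orthonormal is orthogonal to all eigenvectors. -/
theorem inner_eigenvector_eq_zero {U : H ≃ₗᵢ[ℂ] H} {f v : H}
    (hf : Orthonormal ℂ fun n : ℤ => (U ^ n) f) {c : ℂ} (hv : U v = c • v) : inner ℂ f v = 0 := by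
  by_cases hv0 : v = 0
  · rw [hv0, inner_zero_right]
  have hc : ‖c‖ = 1 := by
    have := congrArg norm hv
    rw [LinearIsometryEquiv.norm_map, norm_smul] at this
    exact (mul_eq_right₀ (norm_ne_zero_iff.2 hv0)).1 this.symm
  have hc0 : c ≠ 0 := by rintro rfl; simp at hc
  have hn : ∀ n : ℤ, ‖inner ℂ ((U ^ n) f) v‖ = ‖inner ℂ f v‖ := by
    intro n
    have h1 := inner_zpow_zpow U n 0 f v
    rw [zero_sub, zpow_zero, zpow_eigenvector hc0 hv (-n), inner_smul_right] at h1
    have h2 := congrArg norm h1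
    rwa [norm_mul, norm_zpow, hc, one_zpow, one_mul] at h2
  -- By Bessel's inequality the coefficients tend to zero, but their moduli are all equal.
  have hs := (hf.inner_products_summable v).tendsto_cofinite_zero
  simp only [hn] at hs
  have := tendsto_nhds_unique hs tendsto_const_nhds
  simpa using this.symm

end Spectral

/-! ### The Lebesgue component and weak convergence along powers of two -/

namespace SelfSimilarUnitary

variable {H : Type*} [NormedAddCommGroup H] [InnerProductSpace ℂ H] (S : SelfSimilarUnitary H)

theorem perpGen_of_eigenvector {v : H} {c : ℂ} (hv : S.U v = c • v) : S.PerpGen v := by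
  intro n p
  refine inner_eigenvector_eq_zero (U := S.U) (c := c) ?_ hv
  simp_rw [← isometryEquiv_mul_apply, ← zpow_add]
  exact (S.orthonormal_gen p).comp (fun k : ℤ => k + n) (add_left_injective n)

/-- The exponents `2 ^ k + n` are distinct, so this is a subsequence of the square-summable
coefficients of `g` along an orthonormal family. -/
theorem tendsto_inner_pow_gen (g : H) (n : ℤ) (p : Fin 2) :
    Tendsto (fun k : ℕ => inner ℂ g ((S.U ^ 2 ^ k) ((S.U ^ n) (S.gen p)))) atTop (𝓝 0) := by
  have hs := ((S.orthonormal_gen p).inner_products_summable g).tendsto_cofinite_zero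
  have hk : Tendsto (fun k : ℕ => (2 ^ k + n : ℤ)) atTop cofinite := by
    rw [← Nat.cofinite_eq_atTop]
    refine Function.Injective.tendsto_cofinite fun a b h => ?_
    exact Int.pow_right_injective one_lt_two (add_right_cancel h)
  have h1 := hs.comp hk
  rw [tendsto_zero_iff_norm_tendsto_zero]
  have h2 : Tendsto (fun x : ℝ => √x) (𝓝 0) (𝓝 0) := by
    simpa using (Real.continuous_sqrt.tendsto 0)
  refine (h2.comp h1).congr fun k => ?_
  simp only [Function.comp_apply]
  rw [Real.sqrt_sq (norm_nonneg _), norm_inner_symm, zpow_add, isometryEquiv_mul_apply]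
  norm_cast

variable [CompleteSpace H]

theorem cyl_mem_discretePart (w : List Bool) : S.cyl w ∈ discretePart S.U :=
  Submodule.le_topologicalClosure _
    (mem_span_eigenvectors (c := 1) norm_one (by rw [S.pow_cyl, one_smul]))

theorem hasLebesgueSpectrumOn : HasLebesgueSpectrumOn S.U (discretePart S.U)ᗮ 2 := by
  refine ⟨S.gen, fun p => ⟨volume, isSpectralMeasure_volume (S.orthonormal_gen p),
    Measure.AbsolutelyContinuous.rfl, Measure.AbsolutelyContinuous.rfl⟩, fun p q hpq => ?_, ?_⟩
  · rw [cyclicSpace, Submodule.isOrtho_iff_le]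
    refine Submodule.topologicalClosure_minimal _ ?_ (Submodule.isClosed_orthogonal _)
    rw [Submodule.span_le]
    rintro _ ⟨n, rfl⟩
    rw [SetLike.mem_coe, mem_cyclicSpace_orthogonal_iff]
    exact fun m => S.inner_gen_gen m n q p (Or.inr hpq.symm)
  · have hperp : ∀ x, x ∈ (⨆ i, cyclicSpace S.U (S.gen i))ᗮ ↔ S.PerpGen x := by
      intro x
      rw [← Submodule.iInf_orthogonal, Submodule.mem_iInf]
      simp_rw [mem_cyclicSpace_orthogonal_iff]
      exact forall_comm
    have hle : (⨆ i, cyclicSpace S.U (S.gen i)).topologicalClosure ≤ (discretePart S.U)ᗮ := by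
      rw [discretePart, Submodule.orthogonal_closure, ← Submodule.isOrtho_iff_le,
        Submodule.isOrtho_comm, Submodule.isOrtho_iff_le, Submodule.orthogonal_closure,
        Submodule.span_le]
      rintro v ⟨c, hv⟩
      exact (hperp v).2 (S.perpGen_of_eigenvector hv)
    have : CompleteSpace (⨆ i, cyclicSpace S.U (S.gen i)).topologicalClosure :=
      (Submodule.isClosed_topologicalClosure _).completeSpace_coe
    -- Given the inclusion of closed subspaces, equality means that nothing in the larger one is
    -- orthogonal to the smaller one; such a vector is orthogonal to all cylinders and all generator
    -- translates.
    rw [← Submodule.sup_orthogonal_inf_of_hasOrthogonalProjection hle]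
    suffices h : (⨆ i, cyclicSpace S.U (S.gen i)).topologicalClosureᗮ ⊓ (discretePart S.U)ᗮ = ⊥ by
      rw [h, sup_bot_eq]
    rw [Submodule.orthogonal_closure, eq_bot_iff]
    rintro x ⟨hx1, hx2⟩
    exact S.eq_zero_of_perp (fun w => hx2 _ (S.cyl_mem_discretePart w)) ((hperp x).1 hx1)

/-- Along the powers of two, `U` tends weakly to the projection `(1 + J) / 2`. -/
theorem tendsto_inner_pow (f g : H) :
    Tendsto (fun k : ℕ => inner ℂ g ((S.U ^ 2 ^ k) f)) atTop
      (𝓝 (inner ℂ g ((1 / 2 : ℂ) • (f + S.J f)))) := by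
  -- The vectors for which the convergence holds form a closed subspace, so the cylinders and the
  -- generator translates suffice.
  set K : Submodule ℂ H :=
    { carrier := {f | Tendsto (fun k : ℕ => inner ℂ g ((S.U ^ 2 ^ k) f)) atTop
        (𝓝 (inner ℂ g ((1 / 2 : ℂ) • (f + S.J f))))}
      add_mem' := fun {a b} ha hb => by
        have := ha.add hb
        simp only [Set.mem_ofPred_eq, map_add, inner_add_right]
        convert this using 2
        rw [← inner_add_right]
        congr 1
        module
      zero_mem' := by simp
      smul_mem' := fun c a ha => by
        have := ha.const_mul c
        simp only [Set.mem_ofPred_eq, map_smul, inner_smul_right]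
        convert this using 2
        rw [← inner_smul_right, ← inner_smul_right]
        congr 1
        module } with hK
  have hclosed : IsClosed (K : Set H) := by
    rw [← closure_subset_iff_isClosed]
    intro f hf
    change Tendsto _ _ _
    rw [Metric.tendsto_atTop]
    intro ε hε
    -- Both `U ^ 2 ^ k` and `(1 + J) / 2` are contractions, so an error `δ` in `f` costs at most
    -- `‖g‖ * δ` on either side; the `+ 1` covers `g = 0`.
    set δ := ε / (3 * (‖g‖ + 1)) with hδ
    have hδ0 : 0 < δ := by positivity
    obtain ⟨a, ha, hfa⟩ := Metric.mem_closure_iff.1 hf δ hδ0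
    obtain ⟨N, hN⟩ := Metric.tendsto_atTop.1 (show Tendsto _ _ _ from ha) (ε / 3) (by positivity)
    refine ⟨N, fun k hk => ?_⟩
    have hk := hN k hk
    rw [dist_eq_norm] at hk hfa ⊢
    have hgδ : ‖g‖ * δ ≤ ε / 3 := by
      rw [hδ, mul_div_assoc', div_le_div_iff₀ (by positivity) (by positivity)]
      nlinarith [norm_nonneg g]
    have h1 : ‖inner ℂ g ((S.U ^ 2 ^ k) (f - a))‖ ≤ ‖g‖ * ‖f - a‖ := by
      have := norm_inner_le_norm (𝕜 := ℂ) g ((S.U ^ 2 ^ k) (f - a))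
      rwa [LinearIsometryEquiv.norm_map] at this
    have h2 : ‖inner ℂ g ((1 / 2 : ℂ) • ((f - a) + S.J (f - a)))‖ ≤ ‖g‖ * ‖f - a‖ := by
      refine (norm_inner_le_norm _ _).trans (mul_le_mul_of_nonneg_left ?_ (norm_nonneg _))
      rw [norm_smul]
      have := norm_add_le (f - a) (S.J (f - a))
      rw [LinearIsometryEquiv.norm_map] at this
      rw [show ‖(1 / 2 : ℂ)‖ = 1 / 2 by norm_num]
      linarith
    have h3 : ‖g‖ * ‖f - a‖ ≤ ‖g‖ * δ := by gcongr
    have h4 : inner ℂ g ((S.U ^ 2 ^ k) f) - inner ℂ g ((1 / 2 : ℂ) • (f + S.J f))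
        = (inner ℂ g ((S.U ^ 2 ^ k) a) - inner ℂ g ((1 / 2 : ℂ) • (a + S.J a)))
          + inner ℂ g ((S.U ^ 2 ^ k) (f - a))
          - inner ℂ g ((1 / 2 : ℂ) • ((f - a) + S.J (f - a))) := by
      rw [← inner_sub_right, ← inner_sub_right, ← inner_add_right, ← inner_sub_right]
      congr 1
      rw [map_sub, map_sub]
      module
    rw [h4]
    refine (norm_sub_le _ _).trans_lt ?_
    have := norm_add_le (inner ℂ g ((S.U ^ 2 ^ k) a) - inner ℂ g ((1 / 2 : ℂ) • (a + S.J a)))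
      (inner ℂ g ((S.U ^ 2 ^ k) (f - a)))
    linarith
  have hcyl : ∀ w, S.cyl w ∈ K := by
    intro w
    change Tendsto _ _ _
    refine tendsto_const_nhds.congr' ?_
    filter_upwards [eventually_ge_atTop w.length] with k hk
    obtain ⟨j, rfl⟩ := Nat.exists_eq_add_of_le hk
    have h1 : ∀ i : ℕ, ((S.U ^ 2 ^ w.length) ^ i) (S.cyl w) = S.cyl w := by
      intro i
      induction i with
      | zero => simp
      | succ i ih => rw [pow_succ, isometryEquiv_mul_apply, S.pow_cyl, ih]
    -- From `k = w.length` on, `2 ^ k` is a multiple of the period.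
    rw [pow_add 2, pow_mul, h1, S.J_cyl]
    congr 1
    module
  have hgen : ∀ (n : ℤ) p, (S.U ^ n) (S.gen p) ∈ K := by
    intro n p
    change Tendsto _ _ _
    rw [S.J_zpow, S.J_gen, map_neg, add_neg_cancel, smul_zero, inner_zero_right]
    exact S.tendsto_inner_pow_gen g n p
  have : CompleteSpace K := hclosed.completeSpace_coe
  have htop : K = ⊤ := by
    rw [← Submodule.orthogonal_eq_bot_iff, eq_bot_iff]
    intro x hx
    exact S.eq_zero_of_perp (fun w => hx _ (hcyl w)) fun n p => hx _ (hgen n p)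
  exact (htop ▸ Submodule.mem_top : f ∈ K)

end SelfSimilarUnitary

/-! ### Trigonometric polynomials in a unitary operator -/

section Polynomials

variable {H : Type*} [NormedAddCommGroup H] [InnerProductSpace ℂ H]

/-- The value at `f` of the trigonometric polynomial in `U` with coefficients `a`. -/
def polyApply (U : H ≃ₗᵢ[ℂ] H) (f : H) : (ℤ →₀ ℂ) →ₗ[ℂ] H :=
  Finsupp.linearCombination ℂ fun n : ℤ => (U ^ n) f

/-- The trigonometric polynomial with coefficients `a`. -/
def trigPoly : (ℤ →₀ ℂ) →ₗ[ℂ] C(UnitAddCircle, ℂ) :=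
  Finsupp.linearCombination ℂ fun n : ℤ => (fourier n : C(UnitAddCircle, ℂ))

theorem polyApply_mem_cyclicSpace (U : H ≃ₗᵢ[ℂ] H) (f : H) (a : ℤ →₀ ℂ) :
    polyApply U f a ∈ cyclicSpace U f := by
  rw [polyApply, Finsupp.linearCombination_apply]
  exact Submodule.sum_mem _ fun n _ => Submodule.smul_mem _ _ (zpow_mem_cyclicSpace U f n)

theorem polyApply_zpow (U : H ≃ₗᵢ[ℂ] H) (f : H) (n : ℤ) (a : ℤ →₀ ℂ) :
    polyApply U ((U ^ n) f) a = (U ^ n) (polyApply U f a) := by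
  simp only [polyApply, Finsupp.linearCombination_apply, Finsupp.sum, map_sum, map_smul]
  refine Finset.sum_congr rfl fun m _ => ?_
  rw [← isometryEquiv_mul_apply, ← isometryEquiv_mul_apply, ← zpow_add, ← zpow_add, add_comm]

theorem trigPoly_apply (a : ℤ →₀ ℂ) (t : UnitAddCircle) :
    trigPoly a t = ∑ n ∈ a.support, a n * fourier n t := by
  simp [trigPoly, Finsupp.linearCombination_apply, Finsupp.sum]

theorem inner_polyApply_self (U : H ≃ₗᵢ[ℂ] H) (f : H) (a : ℤ →₀ ℂ) :
    inner ℂ (polyApply U f a) (polyApply U f a) = ∑ n ∈ a.support, ∑ m ∈ a.support,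
      (starRingEnd ℂ) (a n) * a m * inner ℂ f ((U ^ (m - n)) f) := by
  simp only [polyApply, Finsupp.linearCombination_apply, Finsupp.sum, sum_inner, inner_sum,
    inner_smul_left, inner_smul_right, inner_zpow_zpow]
  simp only [Finset.mul_sum]
  rw [Finset.sum_comm]
  exact Finset.sum_congr rfl fun n _ => Finset.sum_congr rfl fun m _ => by ring

/-- A polynomial in a unitary operator is normal: its adjoint, applied to `g` to give the vector `y`
below, produces a vector of the same norm. -/
theorem norm_inner_polyApply_le (U : H ≃ₗᵢ[ℂ] H) (f g : H) (a : ℤ →₀ ℂ) :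
    ‖inner ℂ g (polyApply U f a)‖ ≤ ‖polyApply U g a‖ * ‖f‖ := by
  set y : H := ∑ n ∈ a.support, (starRingEnd ℂ) (a n) • (U ^ (-n)) g with hy
  have h1 : inner ℂ g (polyApply U f a) = inner ℂ y f := by
    simp only [polyApply, Finsupp.linearCombination_apply, Finsupp.sum, sum_inner, inner_sum, hy,
      inner_smul_left, inner_smul_right, Complex.conj_conj]
    refine Finset.sum_congr rfl fun n _ => ?_
    have := inner_zpow_zpow U (-n) 0 g f
    rw [zero_sub, neg_neg, zpow_zero] at this
    rw [← this]
    rfl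
  have h2 : ‖y‖ = ‖polyApply U g a‖ := by
    rw [← sq_eq_sq₀ (norm_nonneg _) (norm_nonneg _)]
    have : (inner ℂ y y : ℂ) = inner ℂ (polyApply U g a) (polyApply U g a) := by
      rw [inner_polyApply_self]
      simp only [hy, sum_inner, inner_sum, inner_smul_left, inner_smul_right, inner_zpow_zpow,
        Complex.conj_conj, Finset.mul_sum]
      refine Finset.sum_congr rfl fun n _ => Finset.sum_congr rfl fun m _ => ?_
      rw [show -n - -m = m - n by ring]
      ring
    rw [inner_self_eq_norm_sq_to_K, inner_self_eq_norm_sq_to_K] at this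
    exact_mod_cast this
  rw [h1, ← h2]
  exact norm_inner_le_norm _ _

theorem enorm_polyApply {U : H ≃ₗᵢ[ℂ] H} {f : H} {ρ : Measure UnitAddCircle}
    (hρ : IsSpectralMeasure U f ρ) (a : ℤ →₀ ℂ) :
    ‖polyApply U f a‖ₑ = eLpNorm (trigPoly a) 2 ρ := by
  obtain ⟨_, hρ⟩ := hρ
  have hmem : MemLp (trigPoly a) 2 ρ :=
    MemLp.of_bound (trigPoly a).continuous.aestronglyMeasurable ‖trigPoly a‖
      (Eventually.of_forall (trigPoly a).norm_coe_le_norm)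
  have h1 : (inner ℂ (polyApply U f a) (polyApply U f a) : ℂ)
      = ∫ t, (starRingEnd ℂ) (trigPoly a t) * trigPoly a t ∂ρ := by
    rw [inner_polyApply_self]
    have : ∀ t, (starRingEnd ℂ) (trigPoly a t) * trigPoly a t = ∑ n ∈ a.support, ∑ m ∈ a.support,
        (starRingEnd ℂ) (a n) * a m * (fourier (m - n) t : ℂ) := by
      intro t
      rw [trigPoly_apply, map_sum, Finset.sum_mul_sum]
      refine Finset.sum_congr rfl fun n _ => Finset.sum_congr rfl fun m _ => ?_
      rw [sub_eq_add_neg, fourier_add, fourier_neg, map_mul]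
      ring
    simp_rw [this]
    rw [integral_finsetSum _ fun n _ => integrable_finsetSum _ fun m _ =>
      (integrable_fourier ρ _).const_mul _]
    refine Finset.sum_congr rfl fun n _ => ?_
    rw [integral_finsetSum _ fun m _ => (integrable_fourier ρ _).const_mul _]
    refine Finset.sum_congr rfl fun m _ => ?_
    rw [integral_const_mul, hρ]
  have h2 : ‖polyApply U f a‖ = ‖hmem.toLp‖ := by
    rw [← sq_eq_sq₀ (norm_nonneg _) (norm_nonneg _)]
    have h3 : (inner ℂ hmem.toLp hmem.toLp : ℂ)
        = inner ℂ (polyApply U f a) (polyApply U f a) := by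
      rw [h1, L2.inner_def]
      refine integral_congr_ae ?_
      filter_upwards [hmem.coeFn_toLp] with t ht
      rw [ht, RCLike.inner_apply, mul_comm]
    rw [inner_self_eq_norm_sq_to_K, inner_self_eq_norm_sq_to_K] at h3
    exact_mod_cast h3.symm
  rw [← ofReal_norm, h2, Lp.norm_toLp, ENNReal.ofReal_toReal hmem.2.ne]

/-- Trigonometric polynomials are uniformly dense in the continuous functions, which are dense in
`L²` of any finite measure on the circle. -/
theorem exists_trigPoly_tendsto (σ : Measure UnitAddCircle) [IsFiniteMeasure σ]
    {A : Set UnitAddCircle} (hA : MeasurableSet A) :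
    ∃ a : ℕ → ℤ →₀ ℂ, Tendsto (fun k => eLpNorm (fun t => trigPoly (a k) t
      - A.indicator (fun _ => (1 : ℂ)) t) 2 σ) atTop (𝓝 0) := by
  have hd := (ContinuousMap.toLp_denseRange ℂ σ ℂ
    (p := 2) (by norm_num)).topologicalClosure_map_submodule
      (span_fourier_closure_eq_top (T := 1))
  have hmem : indicatorConstLp 2 hA (measure_ne_top σ A) (1 : ℂ) ∈ closure
      (Set.range fun a : ℤ →₀ ℂ => ContinuousMap.toLp (E := ℂ) 2 σ ℂ (trigPoly a)) := by
    have h : indicatorConstLp 2 hA (measure_ne_top σ A) (1 : ℂ) ∈ (⊤ : Submodule ℂ (Lp ℂ 2 σ)) :=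
      Submodule.mem_top
    rw [← hd, ← SetLike.mem_coe, Submodule.topologicalClosure_coe] at h
    refine closure_mono ?_ h
    rintro _ ⟨p, hp, rfl⟩
    rw [SetLike.mem_coe, Finsupp.mem_span_range_iff_exists_finsupp] at hp
    obtain ⟨a, rfl⟩ := hp
    exact ⟨a, by simp [trigPoly, Finsupp.linearCombination_apply]⟩
  obtain ⟨x, hx, hlim⟩ := mem_closure_iff_seq_limit.1 hmem
  choose a ha using hx
  refine ⟨a, ?_⟩
  have h := tendsto_iff_edist_tendsto_0.1 hlim
  refine h.congr fun k => ?_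
  rw [Lp.edist_def]
  refine eLpNorm_congr_ae ?_
  rw [← ha k]
  filter_upwards [ContinuousMap.coeFn_toLp σ (p := 2) (𝕜 := ℂ) (trigPoly (a k)),
    indicatorConstLp_coeFn (p := 2) (hs := hA) (hμs := measure_ne_top σ A) (c := (1 : ℂ))]
    with t h1 h2
  simp only [Pi.sub_apply]
  rw [h1, h2]

/-- If the vectors `g i` are total and their spectral measures are dominated by `σ`, then all
spectral measures are absolutely continuous with respect to `σ`. -/
theorem absolutelyContinuous_of_total [CompleteSpace H] {U : H ≃ₗᵢ[ℂ] H} {ι : Type*} {g : ι → H}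
    {τ : ι → Measure UnitAddCircle} (hτ : ∀ i, IsSpectralMeasure U (g i) (τ i))
    {σ : Measure UnitAddCircle} [IsFiniteMeasure σ] {c : ι → ENNReal} (hc : ∀ i, c i ≠ ⊤)
    (hle : ∀ i, τ i ≤ c i • σ) {f : H}
    (htot : ∀ y ∈ cyclicSpace U f, (∀ i (n : ℤ), inner ℂ ((U ^ n) (g i)) y = 0) → y = 0)
    {ρ : Measure UnitAddCircle} (hρ : IsSpectralMeasure U f ρ) : ρ ≪ σ := by
  refine Measure.AbsolutelyContinuous.mk fun A hA hσA => ?_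
  have := hρ.1
  -- Approximation with respect to the sum of the measures controls `ρ` and every `τ i` by the same
  -- polynomials.
  obtain ⟨a, ha⟩ := exists_trigPoly_tendsto (ρ + σ) hA
  have hmeas : ∀ (ν : Measure UnitAddCircle) (b : ℤ →₀ ℂ),
      AEStronglyMeasurable (fun t => trigPoly b t) ν :=
    fun ν b => (trigPoly b).continuous.aestronglyMeasurable
  have hind : ∀ ν : Measure UnitAddCircle,
      AEStronglyMeasurable (A.indicator fun _ => (1 : ℂ)) ν :=
    fun ν => aestronglyMeasurable_const.indicator hA
  have haρ : Tendsto (fun k => eLpNorm (fun t => trigPoly (a k) t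
      - A.indicator (fun _ => (1 : ℂ)) t) 2 ρ) atTop (𝓝 0) :=
    tendsto_of_tendsto_of_tendsto_of_le_of_le tendsto_const_nhds ha (fun _ => zero_le)
      fun k => eLpNorm_mono_measure _ (Measure.le_add_right le_rfl)
  have hg : ∀ i, Tendsto (fun k => polyApply U (g i) (a k)) atTop (𝓝 0) := by
    intro i
    rw [tendsto_iff_edist_tendsto_0]
    simp only [edist_zero_right, enorm_polyApply (hτ i)]
    have h0 : Tendsto (fun k => c i ^ (1 / (2 : ENNReal)).toReal * eLpNorm (fun t =>
        trigPoly (a k) t - A.indicator (fun _ => (1 : ℂ)) t) 2 (ρ + σ)) atTop (𝓝 0) := by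
      have := ENNReal.Tendsto.const_mul (a := c i ^ (1 / (2 : ENNReal)).toReal) ha
        (Or.inr (ENNReal.rpow_ne_top_of_nonneg ENNReal.toReal_nonneg (hc i)))
      rwa [mul_zero] at this
    refine tendsto_of_tendsto_of_tendsto_of_le_of_le tendsto_const_nhds h0 (fun _ => zero_le)
      fun k => ?_
    -- The set is null for `τ i`, so the polynomials tend to zero in its `L²`, which by
    -- `enorm_polyApply` means that they annihilate `g i` in the limit.
    have hτA : τ i A = 0 := by
      refine le_antisymm ((hle i A).trans ?_) zero_le
      simp [hσA]
    have h1 : eLpNorm (trigPoly (a k)) 2 (τ i) = eLpNorm (fun t => trigPoly (a k) t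
        - A.indicator (fun _ => (1 : ℂ)) t) 2 (τ i) := by
      refine eLpNorm_congr_ae ?_
      filter_upwards [measure_eq_zero_iff_ae_notMem.1 hτA] with t ht
      simp [ht]
    rw [h1]
    refine (eLpNorm_mono_measure _ ((hle i).trans ?_)).trans
      (eLpNorm_smul_measure_of_ne_top (by norm_num) _ _).le
    gcongr
    exact Measure.le_add_left le_rfl
  have hcauchy : CauchySeq fun k => polyApply U f (a k) := by
    rw [EMetric.cauchySeq_iff]
    intro ε hε
    set δ := min ε 1 with hδ
    have hδ0 : δ ≠ 0 := (lt_min hε one_pos).ne'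
    have hδt : δ ≠ ⊤ := ((min_le_right ε 1).trans_lt ENNReal.one_lt_top).ne
    have hδ3 : δ / 3 ≠ ⊤ := ENNReal.div_ne_top hδt (by norm_num)
    have hδ3' : 0 < δ / 3 := ENNReal.div_pos hδ0 (by norm_num)
    obtain ⟨N, hN⟩ := (ENNReal.tendsto_atTop_zero.1 haρ) (δ / 3) hδ3'
    refine ⟨N, fun m hm n hn => ?_⟩
    rw [edist_eq_enorm_sub, ← map_sub, enorm_polyApply hρ]
    have h1 : eLpNorm (trigPoly (a m - a n)) 2 ρ ≤ δ / 3 + δ / 3 := by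
      refine le_trans (le_of_eq ?_) ((eLpNorm_sub_le ((hmeas ρ (a m)).sub (hind ρ))
        ((hmeas ρ (a n)).sub (hind ρ)) (by norm_num)).trans (add_le_add (hN m hm) (hN n hn)))
      congr 1
      ext t
      simp
    refine (h1.trans_lt ?_).trans_le (min_le_left ε 1)
    calc δ / 3 + δ / 3 < δ / 3 + δ / 3 + δ / 3 :=
          ENNReal.lt_add_right (ENNReal.add_ne_top.2 ⟨hδ3, hδ3⟩) hδ3'.ne'
      _ = δ := ENNReal.add_thirds δ
  obtain ⟨y, hy⟩ := cauchySeq_tendsto_of_complete hcauchy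
  -- The limit plays the role of the spectral projection of `A` applied to `f`. Normality transfers
  -- smallness on `g i` to orthogonality of `y` to all translates of `g i`, and totality gives zero.
  have hy0 : y = 0 := by
    refine htot y ?_ fun i n => ?_
    · exact (Submodule.isClosed_topologicalClosure _).mem_of_tendsto hy
        (Eventually.of_forall fun k => polyApply_mem_cyclicSpace U f (a k))
    · have h1 : Tendsto (fun k => inner ℂ ((U ^ n) (g i)) (polyApply U f (a k))) atTop
          (𝓝 (inner ℂ ((U ^ n) (g i)) y)) := tendsto_const_nhds.inner hy
      refine tendsto_nhds_unique h1 ?_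
      have h2 : Tendsto (fun k => ‖polyApply U (g i) (a k)‖ * ‖f‖) atTop (𝓝 0) := by
        have := (hg i).norm.mul_const ‖f‖
        rwa [norm_zero, zero_mul] at this
      refine squeeze_zero_norm (fun k => ?_) h2
      refine (norm_inner_polyApply_le U f _ (a k)).trans_eq ?_
      rw [polyApply_zpow, LinearIsometryEquiv.norm_map]
  -- The norms of the vectors also converge to the `L²(ρ)` norm of the indicator, so `A` is
  -- `ρ`-null.
  have hfin : eLpNorm (A.indicator fun _ => (1 : ℂ)) 2 ρ = 0 := by
    have h1 : Tendsto (fun k => ‖polyApply U f (a k)‖ₑ + eLpNorm (fun t => trigPoly (a k) t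
      - A.indicator (fun _ => (1 : ℂ)) t) 2 ρ) atTop (𝓝 0) := by
      have := hy.enorm.add haρ
      rwa [hy0, enorm_zero, add_zero] at this
    refine le_antisymm (ge_of_tendsto h1 (Eventually.of_forall fun k => ?_)) zero_le
    rw [enorm_polyApply hρ]
    refine le_trans (le_of_eq ?_) (eLpNorm_sub_le (hmeas ρ (a k))
      ((hmeas ρ (a k)).sub (hind ρ)) (by norm_num))
    congr 1
    ext t
    simp
  rw [eLpNorm_indicator_const hA (by norm_num) (by norm_num)] at hfin
  simpa using hfin

end Polynomials

/-! ### The reduced maximal spectral type -/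

namespace SelfSimilarUnitary

variable {H : Type*} [NormedAddCommGroup H] [InnerProductSpace ℂ H] (S : SelfSimilarUnitary H)

theorem inner_e_gen (p : Fin 2) : inner ℂ S.e (S.gen p) = 0 := by
  have h : inner ℂ S.e (S.gen p) = -inner ℂ S.e (S.gen p) := by
    conv_lhs => rw [← S.J_e, inner_involution S.J_J, J_gen, inner_neg_right]
  linear_combination (1 / 2 : ℂ) * h

theorem inner_e_e : inner ℂ S.e S.e = 1 := by
  rw [inner_self_eq_norm_sq_to_K, S.norm_e]; simp

theorem inner_e_of_mem_cyclicSpace {f : H} (hf : inner ℂ S.e f = 0) {y : H}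
    (hy : y ∈ cyclicSpace S.U f) : inner ℂ S.e y = 0 := by
  have he : S.e ∈ (cyclicSpace S.U f)ᗮ := by
    rw [mem_cyclicSpace_orthogonal_iff]
    intro n
    have h1 : (S.U ^ n) S.e = S.e := by
      have := zpow_eigenvector one_ne_zero (show S.U S.e = (1 : ℂ) • S.e by
        rw [S.U_e, one_smul]) n
      rwa [one_zpow, one_smul] at this
    rw [← h1, LinearIsometryEquiv.inner_map_map, inner_eq_zero_symm, hf]
  exact inner_eq_zero_symm.1 (he y hy)

variable [CompleteSpace H]

/-- A total family of vectors orthogonal to `e`. -/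
def total : Fin 2 ⊕ List Bool → H
  | Sum.inl p => S.gen p
  | Sum.inr w => S.cyl w - inner ℂ S.e (S.cyl w) • S.e

theorem inner_e_total (i : Fin 2 ⊕ List Bool) : inner ℂ S.e (S.total i) = 0 := by
  rcases i with p | w
  · exact S.inner_e_gen p
  · rw [total, inner_sub_right, inner_smul_right, inner_e_e, mul_one, sub_self]

theorem exists_isSpectralMeasure_total (i : Fin 2 ⊕ List Bool) :
    ∃ σ, IsSpectralMeasure S.U (S.total i) σ := by
  rcases i with p | w
  · exact ⟨volume, isSpectralMeasure_volume (S.orthonormal_gen p)⟩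
  · refine exists_isSpectralMeasure_of_pow (c := 1) (n := w.length) norm_one ?_
    have he : ∀ n : ℕ, (S.U ^ n) S.e = S.e := by
      intro n
      induction n with
      | zero => simp
      | succ n ih => rw [pow_succ, isometryEquiv_mul_apply, S.U_e, ih]
    rw [one_smul, total, map_sub, map_smul, S.pow_cyl, he]

theorem eq_zero_of_perp_total {h : H} (he : inner ℂ S.e h = 0)
    (ht : ∀ i (n : ℤ), inner ℂ ((S.U ^ n) (S.total i)) h = 0) : h = 0 := by
  refine S.eq_zero_of_perp (fun w => ?_) fun n p => ht (Sum.inl p) n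
  have := ht (Sum.inr w) 0
  rw [zpow_zero] at this
  change inner ℂ (S.cyl w - inner ℂ S.e (S.cyl w) • S.e) h = 0 at this
  rwa [inner_sub_left, inner_smul_left, he, mul_zero, sub_zero] at this

/-- The smallest measure class that dominates the spectral measures of the vectors orthogonal
to `e`. -/
theorem exists_maximalSpectralType :
    ∃ σ : Measure UnitAddCircle, IsFiniteMeasure σ ∧
      (∀ f, inner ℂ S.e f = 0 → ∀ ρ, IsSpectralMeasure S.U f ρ → ρ ≪ σ) ∧
      ∀ ν : Measure UnitAddCircle,
        (∀ f, inner ℂ S.e f = 0 → ∀ ρ, IsSpectralMeasure S.U f ρ → ρ ≪ ν) → σ ≪ ν := by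
  choose τ hτ using S.exists_isSpectralMeasure_total
  -- Positive weights keep each `τ i` dominated by a multiple of the sum; their smallness makes the
  -- sum finite.
  obtain ⟨δ, hδ, hsum⟩ := ENNReal.exists_pos_tsum_mul_lt_of_countable one_ne_zero
    (fun i => τ i Set.univ) fun i => (hτ i).1.measure_univ_lt_top.ne
  set σ := Measure.sum fun i => (δ i : ENNReal) • τ i with hσ
  have hfin : IsFiniteMeasure σ := by
    refine ⟨?_⟩
    rw [hσ, Measure.sum_apply _ MeasurableSet.univ]
    refine lt_of_le_of_lt (le_of_eq (tsum_congr fun i => ?_)) (hsum.trans ENNReal.one_lt_top)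
    rw [Measure.smul_apply, smul_eq_mul, mul_comm]
  refine ⟨σ, hfin, fun f hf ρ hρ => ?_, fun ν hν => ?_⟩
  · have hδ0 : ∀ i, (δ i : ENNReal) ≠ 0 := fun i => by exact_mod_cast (hδ i).ne'
    refine absolutelyContinuous_of_total hτ (c := fun i => (δ i : ENNReal)⁻¹)
      (fun i => ENNReal.inv_ne_top.2 (hδ0 i)) (fun i => ?_)
      (fun y hy h => S.eq_zero_of_perp_total (S.inner_e_of_mem_cyclicSpace hf hy) h) hρ
    have h1 : (δ i : ENNReal) • τ i ≤ σ := Measure.le_sum _ i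
    calc τ i = (δ i : ENNReal)⁻¹ • (δ i : ENNReal) • τ i := by
          rw [smul_smul, ENNReal.inv_mul_cancel (hδ0 i) ENNReal.coe_ne_top, one_smul]
      _ ≤ _ := by gcongr
  · exact Measure.absolutelyContinuous_sum_left fun i =>
      (hν _ (S.inner_e_total i) _ (hτ i)).smul_left _

end SelfSimilarUnitary

/-! ### The self-similar structure of the odometer -/

/-- The contraction of `[0, 1)` onto `[0, 1/2)`. -/
def lower (x : I01) : I01 := ⟨(x : ℝ) / 2, by obtain ⟨x, h0, h1⟩ := x; constructor <;> linarith⟩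

/-- The contraction of `[0, 1)` onto `[1/2, 1)`. -/
def upper (x : I01) : I01 :=
  ⟨((x : ℝ) + 1) / 2, by obtain ⟨x, h0, h1⟩ := x; constructor <;> linarith⟩

/-- The first binary digit. -/
def digit (x : I01) : ZMod 2 := if (x : ℝ) < 1 / 2 then 0 else 1

theorem eq_lower_or_upper (x : I01) : (∃ y, x = lower y) ∨ ∃ y, x = upper y := by
  obtain ⟨x, h0, h1⟩ := x
  rcases lt_or_ge x (1 / 2) with h | h
  · exact Or.inl ⟨⟨2 * x, by constructor <;> linarith⟩, Subtype.ext (by simp [lower])⟩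
  · exact Or.inr ⟨⟨2 * x - 1, by constructor <;> linarith⟩, Subtype.ext (by simp [upper])⟩

theorem digit_lower (x : I01) : digit (lower x) = 0 := by
  obtain ⟨x, h0, h1⟩ := x
  rw [digit, if_pos]
  change x / 2 < 1 / 2
  linarith

theorem digit_upper (x : I01) : digit (upper x) = 1 := by
  obtain ⟨x, h0, h1⟩ := x
  rw [digit, if_neg]
  change ¬ (x + 1) / 2 < 1 / 2
  linarith

theorem level_eq {x : I01} {n : ℕ} (h1 : (1 - 1 / 2 ^ n : ℝ) ≤ x)
    (h2 : (x : ℝ) < 1 - 1 / 2 ^ (n + 1)) : level x = n := by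
  obtain ⟨h3, h4⟩ := level_mem x
  have key : ∀ a b : ℕ, a + 1 ≤ b → (1 - 1 / 2 ^ (a + 1) : ℝ) ≤ 1 - 1 / 2 ^ b := by
    intro a b hab
    have : (1 / 2 ^ b : ℝ) ≤ 1 / 2 ^ (a + 1) :=
      one_div_le_one_div_of_le (by positivity) (pow_le_pow_right₀ (by norm_num) hab)
    linarith
  rcases lt_trichotomy (level x) n with h | h | h
  · have := key _ _ h
    linarith
  · exact h
  · have := key _ _ h
    linarith

theorem level_lower (x : I01) : level (lower x) = 0 := by
  obtain ⟨x, h0, h1⟩ := x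
  refine level_eq ?_ ?_
  · change _ ≤ x / 2
    norm_num
    linarith
  · change x / 2 < _
    norm_num
    linarith

theorem level_upper (x : I01) : level (upper x) = level x + 1 := by
  obtain ⟨h1, h2⟩ := level_mem x
  have e1 : (1 / 2 ^ (level x + 1) : ℝ) = 1 / 2 ^ level x / 2 := by rw [pow_succ]; field_simp
  have e2 : (1 / 2 ^ (level x + 1 + 1) : ℝ) = 1 / 2 ^ level x / 4 := by
    rw [pow_succ, pow_succ]; field_simp; norm_num
  rw [e1] at h2
  refine level_eq ?_ ?_
  · change _ ≤ ((x : ℝ) + 1) / 2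
    rw [e1]
    linarith
  · change ((x : ℝ) + 1) / 2 < _
    rw [e2]
    linarith

theorem odometer_lower (x : I01) : odometer (lower x) = upper x := by
  refine Subtype.ext ?_
  change (x : ℝ) / 2 - (1 - 1 / 2 ^ level (lower x)) + 1 / 2 ^ (level (lower x) + 1)
    = ((x : ℝ) + 1) / 2
  rw [level_lower]
  norm_num
  ring

/-- Addition with carry: a leading digit `1` becomes `0` and the odometer continues on the remaining
digits. -/
theorem odometer_upper (x : I01) : odometer (upper x) = lower (odometer x) := by
  refine Subtype.ext ?_
  change ((x : ℝ) + 1) / 2 - (1 - 1 / 2 ^ level (upper x)) + 1 / 2 ^ (level (upper x) + 1)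
    = ((x : ℝ) - (1 - 1 / 2 ^ level x) + 1 / 2 ^ (level x + 1)) / 2
  rw [level_upper, pow_succ (2 : ℝ) (level x + 1), pow_succ (2 : ℝ) (level x)]
  field_simp
  ring

theorem cocycle_lower (x : I01) : cocycle (lower x) = digit x := by
  rw [cocycle, level_lower, digit]
  refine if_congr ?_ rfl rfl
  change (x : ℝ) / 2 < _ ↔ _
  norm_num
  constructor <;> intro h <;> linarith

theorem cocycle_upper (x : I01) : cocycle (upper x) = cocycle x := by
  rw [cocycle, level_upper, cocycle]
  refine if_congr ?_ rfl rfl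
  change ((x : ℝ) + 1) / 2 < _ ↔ _
  have e1 : (1 / 2 ^ (level x + 1) : ℝ) = 1 / 2 ^ level x / 2 := by rw [pow_succ]; field_simp
  have e2 : (1 / 2 ^ (level x + 1 + 2) : ℝ) = 1 / 2 ^ (level x + 2) / 2 := by
    rw [add_right_comm, pow_succ]; field_simp
  rw [e1, e2]
  constructor <;> intro h <;> linarith

theorem digit_odometer (x : I01) : digit (odometer x) = 1 + digit x := by
  rcases eq_lower_or_upper x with ⟨y, rfl⟩ | ⟨y, rfl⟩
  · rw [odometer_lower, digit_upper, digit_lower, add_zero]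
  · rw [odometer_upper, digit_upper, digit_lower]
    decide

theorem odometer_injective : Function.Injective odometer := by
  intro x y hxy
  -- The images determine the first digit. On the lower half injectivity is immediate; on the upper
  -- half the question recurs for the remaining digits and distances are halved.
  have key : ∀ (n : ℕ) (x y : I01), odometer x = odometer y → |(x : ℝ) - y| ≤ (1 / 2) ^ n := by
    intro n
    induction n with
    | zero =>
      rintro ⟨x, hx0, hx1⟩ ⟨y, hy0, hy1⟩ -
      rw [pow_zero, abs_le]
      constructor <;> simp only <;> linarith
    | succ n ih =>
      intro x y hxy
      have hd : digit x = digit y := by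
        have := congrArg digit hxy
        rwa [digit_odometer, digit_odometer, add_right_inj] at this
      rcases eq_lower_or_upper x with ⟨x, rfl⟩ | ⟨x, rfl⟩ <;>
      rcases eq_lower_or_upper y with ⟨y, rfl⟩ | ⟨y, rfl⟩
      · rw [odometer_lower, odometer_lower, Subtype.ext_iff] at hxy
        change ((x : ℝ) + 1) / 2 = (y + 1) / 2 at hxy
        have : (x : ℝ) = y := by linarith
        rw [Subtype.ext this, sub_self, abs_zero]
        positivity
      · rw [digit_lower, digit_upper] at hd
        exact absurd hd (by decide)
      · rw [digit_lower, digit_upper] at hd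
        exact absurd hd (by decide)
      · rw [odometer_upper, odometer_upper, Subtype.ext_iff] at hxy
        change (odometer x : ℝ) / 2 = odometer y / 2 at hxy
        have := ih x y (Subtype.ext (by linarith))
        change |((x : ℝ) + 1) / 2 - (y + 1) / 2| ≤ _
        rw [show ((x : ℝ) + 1) / 2 - (y + 1) / 2 = (1 / 2) * (x - y) by ring, abs_mul, pow_succ',
          abs_of_pos (by norm_num : (0 : ℝ) < 1 / 2)]
        gcongr
  have hlim : Tendsto (fun n : ℕ => (1 / 2 : ℝ) ^ n) atTop (𝓝 0) :=
    tendsto_pow_atTop_nhds_zero_of_lt_one (by norm_num) (by norm_num)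
  have h := ge_of_tendsto' hlim fun n => key n x y hxy
  exact Subtype.ext (sub_eq_zero.1 (abs_nonpos_iff.1 h))

theorem measurable_level : Measurable level := by
  refine measurable_to_countable' fun n => ?_
  have : level ⁻¹' {n} = {x : I01 | (1 - 1 / 2 ^ n : ℝ) ≤ x ∧ (x : ℝ) < 1 - 1 / 2 ^ (n + 1)} := by
    ext x
    constructor
    · rintro rfl
      exact level_mem x
    · rintro ⟨h1, h2⟩
      exact level_eq h1 h2
  rw [this]
  exact (measurableSet_le measurable_const measurable_subtype_coe).inter
    (measurableSet_lt measurable_subtype_coe measurable_const)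

theorem measurable_odometer : Measurable odometer := by
  refine Measurable.subtype_mk ?_
  have h : ∀ f : ℕ → ℝ, Measurable fun x => f (level x) := fun f =>
    measurable_from_top.comp measurable_level
  exact (measurable_subtype_coe.sub (h fun n => 1 - 1 / 2 ^ n)).add (h fun n => 1 / 2 ^ (n + 1))

theorem measurable_cocycle : Measurable cocycle := by
  have h : ∀ f : ℕ → ℝ, Measurable fun x => f (level x) := fun f =>
    measurable_from_top.comp measurable_level
  exact Measurable.ite (measurableSet_lt measurable_subtype_coe
    (h fun n => 1 - 1 / 2 ^ n + 1 / 2 ^ (n + 2))) measurable_const measurable_const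

theorem measurable_digit : Measurable digit :=
  Measurable.ite (measurableSet_lt measurable_subtype_coe measurable_const) measurable_const
    measurable_const

theorem measurable_lower : Measurable lower :=
  Measurable.subtype_mk (measurable_subtype_coe.div_const 2)

theorem measurable_upper : Measurable upper :=
  Measurable.subtype_mk ((measurable_subtype_coe.add_const 1).div_const 2)

/-- Lebesgue measure on `[0, 1)`. -/
abbrev leb : Measure I01 := Measure.comap ((↑) : I01 → ℝ) volume

theorem leb_apply (A : Set I01) : leb A = volume ((↑) '' A : Set ℝ) :=
  (MeasurableEmbedding.subtype_coe measurableSet_Ico).comap_apply _ _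

instance : IsProbabilityMeasure leb := by
  refine ⟨?_⟩
  rw [leb_apply, Set.image_univ, Subtype.range_coe]
  simp

theorem leb_lower_preimage (A : Set I01) :
    leb (lower ⁻¹' A) = 2 * volume ((↑) '' A ∩ Set.Iio (1 / 2) : Set ℝ) := by
  have h : ((↑) '' (lower ⁻¹' A) : Set ℝ) =
      (fun x => (1 / 2) * x) ⁻¹' ((↑) '' A ∩ Set.Iio (1 / 2)) := by
    ext x
    constructor
    · rintro ⟨x, hx, rfl⟩
      refine ⟨⟨lower x, hx, by simp [lower]; ring⟩, ?_⟩
      have := x.2.2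
      change 1 / 2 * (x : ℝ) < 1 / 2
      linarith
    · rintro ⟨⟨y, hy, hyx⟩, hx⟩
      have := y.2.1
      change 1 / 2 * x < 1 / 2 at hx
      refine ⟨⟨x, by constructor <;> linarith⟩, ?_, rfl⟩
      have : lower ⟨x, by constructor <;> linarith⟩ = y := Subtype.ext (by simp [lower, hyx]; ring)
      rw [Set.mem_preimage, this]
      exact hy
  rw [leb_apply, h, Real.volume_preimage_mul_left (by norm_num)]
  norm_num

theorem leb_upper_preimage (A : Set I01) :
    leb (upper ⁻¹' A) = 2 * volume ((↑) '' A \ Set.Iio (1 / 2) : Set ℝ) := by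
  have h : ((↑) '' (upper ⁻¹' A) : Set ℝ) = (fun x => x + 1) ⁻¹'
      ((fun x => (1 / 2) * x) ⁻¹' ((↑) '' A \ Set.Iio (1 / 2))) := by
    ext x
    constructor
    · rintro ⟨x, hx, rfl⟩
      refine ⟨⟨upper x, hx, by simp [upper]; ring⟩, ?_⟩
      have := x.2.1
      change ¬ 1 / 2 * ((x : ℝ) + 1) < 1 / 2
      linarith
    · rintro ⟨⟨y, hy, hyx⟩, hx⟩
      have := y.2.2
      change ¬ 1 / 2 * (x + 1) < 1 / 2 at hx
      refine ⟨⟨x, by constructor <;> linarith⟩, ?_, rfl⟩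
      have : upper ⟨x, by constructor <;> linarith⟩ = y := Subtype.ext (by simp [upper, hyx]; ring)
      rw [Set.mem_preimage, this]
      exact hy
  rw [leb_apply, h, measure_preimage_add_right, Real.volume_preimage_mul_left (by norm_num)]
  norm_num

theorem leb_eq : leb = (1 / 2 : ENNReal) • leb.map lower + (1 / 2 : ENNReal) • leb.map upper := by
  refine Measure.ext fun A hA => ?_
  rw [Measure.add_apply, Measure.smul_apply, Measure.smul_apply,
    Measure.map_apply measurable_lower hA, Measure.map_apply measurable_upper hA,
    leb_lower_preimage, leb_upper_preimage, smul_eq_mul,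
    smul_eq_mul, ← mul_assoc, ← mul_assoc]
  rw [one_div, ENNReal.inv_mul_cancel (by norm_num) (by norm_num), one_mul, one_mul,
    measure_inter_add_sdiff _ measurableSet_Iio, leb_apply]

/-! ### The measure space and its self-maps -/

instance : IsProbabilityMeasure haarZ2 := by
  refine ⟨?_⟩
  simp [haarZ2, ENNReal.inv_two_add_inv_two]

instance : IsProbabilityMeasure mnMeasure := by
  unfold mnMeasure
  infer_instance

theorem map_add_haarZ2 (g : ZMod 2) : haarZ2.map (fun h => g + h) = haarZ2 := by
  have hm : Measurable fun h : ZMod 2 => g + h := measurable_from_top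
  rw [haarZ2, Measure.map_add _ _ hm, Measure.map_smul, Measure.map_smul, Measure.map_dirac' hm,
    Measure.map_dirac' hm]
  have : g = 0 ∨ g = 1 := by clear hm; revert g; decide
  rcases this with rfl | rfl
  · simp
  · rw [add_zero, show (1 + 1 : ZMod 2) = 0 from rfl, add_comm]

/-- The contraction of the space onto the part where the first digit is `0`. -/
def lowerProd (p : I01 × ZMod 2) : I01 × ZMod 2 := (lower p.1, p.2)

/-- The contraction of the space onto the part where the first digit is `1`. -/
def upperProd (p : I01 × ZMod 2) : I01 × ZMod 2 := (upper p.1, p.2)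

/-- The translation of the fibres by `1`. -/
def flip (p : I01 × ZMod 2) : I01 × ZMod 2 := (p.1, 1 + p.2)

/-- The translation of the fibres by the first digit. -/
def twist (p : I01 × ZMod 2) : I01 × ZMod 2 := (p.1, digit p.1 + p.2)

theorem measurable_lowerProd : Measurable lowerProd :=
  (measurable_lower.comp measurable_fst).prodMk measurable_snd

theorem measurable_upperProd : Measurable upperProd :=
  (measurable_upper.comp measurable_fst).prodMk measurable_snd

theorem measurable_transformation : Measurable transformation :=
  (measurable_odometer.comp measurable_fst).prodMk
    ((measurable_cocycle.comp measurable_fst).add measurable_snd)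

theorem mnMeasure_eq : mnMeasure = (1 / 2 : ENNReal) • mnMeasure.map lowerProd
    + (1 / 2 : ENNReal) • mnMeasure.map upperProd := by
  have h1 : mnMeasure.map lowerProd = (leb.map lower).prod haarZ2 := by
    conv_rhs => rw [← Measure.map_id (μ := haarZ2)]
    exact (Measure.map_prod_map _ _ measurable_lower measurable_id).symm
  have h2 : mnMeasure.map upperProd = (leb.map upper).prod haarZ2 := by
    conv_rhs => rw [← Measure.map_id (μ := haarZ2)]
    exact (Measure.map_prod_map _ _ measurable_upper measurable_id).symm
  rw [h1, h2, ← Measure.prod_smul_left, ← Measure.prod_smul_left, ← Measure.add_prod, ← leb_eq]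
  rfl

theorem measurePreserving_flip : MeasurePreserving flip mnMeasure mnMeasure :=
  (MeasurePreserving.id leb).skew_product (g := fun _ h => 1 + h)
    (measurable_snd.const_add 1) (Eventually.of_forall fun _ => map_add_haarZ2 1)

theorem measurePreserving_twist : MeasurePreserving twist mnMeasure mnMeasure :=
  (MeasurePreserving.id leb).skew_product (g := fun x h => digit x + h)
    ((measurable_digit.comp measurable_fst).add measurable_snd)
    (Eventually.of_forall fun x => map_add_haarZ2 (digit x))

theorem transformation_lowerProd (p : I01 × ZMod 2) :
    transformation (lowerProd p) = upperProd (twist p) := by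
  simp [transformation, lowerProd, upperProd, twist, odometer_lower, cocycle_lower]

theorem transformation_upperProd (p : I01 × ZMod 2) :
    transformation (upperProd p) = lowerProd (transformation p) := by
  simp [transformation, lowerProd, upperProd, odometer_upper, cocycle_upper]

/-- The odometer changes the first digit, so the two twists differ by a flip. This is the source of
the anticommutation of `C` and `U` on odd functions. -/
theorem twist_transformation (p : I01 × ZMod 2) :
    twist (transformation p) = flip (transformation (twist p)) := by
  simp only [transformation, twist, flip, digit_odometer]
  ext1
  · rfl
  · simp only
    ring

theorem flip_flip (p : I01 × ZMod 2) : flip (flip p) = p := by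
  simp only [flip]
  rw [← add_assoc, show (1 + 1 : ZMod 2) = 0 from rfl, zero_add]

theorem twist_twist (p : I01 × ZMod 2) : twist (twist p) = p := by
  simp only [twist]
  rw [← add_assoc, CharTwo.add_self_eq_zero, zero_add]

theorem transformation_flip (p : I01 × ZMod 2) :
    transformation (flip p) = flip (transformation p) := by
  simp only [transformation, flip]
  rw [add_left_comm]

theorem twist_flip (p : I01 × ZMod 2) : twist (flip p) = flip (twist p) := by
  simp only [twist, flip]
  rw [add_left_comm]

theorem twist_lowerProd (p : I01 × ZMod 2) : twist (lowerProd p) = lowerProd p := by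
  simp [twist, lowerProd, digit_lower]

theorem twist_upperProd (p : I01 × ZMod 2) : twist (upperProd p) = flip (upperProd p) := by
  simp [twist, flip, upperProd, digit_upper]

theorem twist_eq_or (p : I01 × ZMod 2) : twist p = p ∨ twist p = flip p := by
  rcases eq_lower_or_upper p.1 with ⟨y, hy⟩ | ⟨y, hy⟩
  · left
    rw [twist, hy, digit_lower, ← hy, zero_add]
  · right
    rw [twist, hy, digit_upper, ← hy, flip]

theorem transformation_injective : Function.Injective transformation := by
  rintro ⟨x, g⟩ ⟨y, h⟩ hxy
  simp only [transformation, Prod.mk.injEq] at hxy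
  obtain ⟨h1, h2⟩ := hxy
  obtain rfl := odometer_injective h1
  rw [add_left_cancel h2]

theorem measurePreserving_transformation :
    MeasurePreserving transformation mnMeasure mnMeasure := by
  refine ⟨measurable_transformation, ?_⟩
  have hsplit : ∀ A, MeasurableSet A → mnMeasure.real A
      = (1 / 2) * mnMeasure.real (lowerProd ⁻¹' A)
        + (1 / 2) * mnMeasure.real (upperProd ⁻¹' A) := by
    intro A hA
    have h := congrArg (fun μ : Measure (I01 × ZMod 2) => (μ A).toReal) mnMeasure_eq
    simp only [Measure.add_apply, Measure.smul_apply, smul_eq_mul] at h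
    rw [Measure.map_apply measurable_lowerProd hA, Measure.map_apply measurable_upperProd hA,
      ENNReal.toReal_add (by finiteness) (by finiteness), ENNReal.toReal_mul, ENNReal.toReal_mul]
      at h
    simpa [Measure.real] using h
  -- After splitting `A` between the halves, one half contributes no defect because the twist
  -- preserves the measure; the other repeats the problem with weight `1 / 2`.
  have key : ∀ (n : ℕ) (A : Set (I01 × ZMod 2)), MeasurableSet A →
      |mnMeasure.real (transformation ⁻¹' A) - mnMeasure.real A| ≤ (1 / 2) ^ n := by
    intro n
    induction n with
    | zero =>
      intro A _
      rw [pow_zero, abs_le]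
      constructor <;> linarith [measureReal_nonneg (μ := mnMeasure) (s := A),
        measureReal_nonneg (μ := mnMeasure) (s := transformation ⁻¹' A),
        measureReal_le_one (μ := mnMeasure) (s := A),
        measureReal_le_one (μ := mnMeasure) (s := transformation ⁻¹' A)]
    | succ n ih =>
      intro A hA
      have h1 : lowerProd ⁻¹' (transformation ⁻¹' A) = twist ⁻¹' (upperProd ⁻¹' A) := by
        ext p; simp [transformation_lowerProd]
      have h2 : upperProd ⁻¹' (transformation ⁻¹' A) = transformation ⁻¹' (lowerProd ⁻¹' A) := by
        ext p; simp [transformation_upperProd]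
      have h3 := ih _ (measurable_lowerProd hA)
      rw [hsplit _ (measurable_transformation hA), hsplit A hA, h1, h2,
        measurePreserving_twist.measureReal_preimage (measurable_upperProd hA).nullMeasurableSet,
        pow_succ']
      have : (1 / 2) * mnMeasure.real (upperProd ⁻¹' A)
          + (1 / 2) * mnMeasure.real (transformation ⁻¹' (lowerProd ⁻¹' A))
          - ((1 / 2) * mnMeasure.real (lowerProd ⁻¹' A)
            + (1 / 2) * mnMeasure.real (upperProd ⁻¹' A))
          = (1 / 2) * (mnMeasure.real (transformation ⁻¹' (lowerProd ⁻¹' A))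
            - mnMeasure.real (lowerProd ⁻¹' A)) := by ring
      rw [this, abs_mul, abs_of_pos (by norm_num : (0 : ℝ) < 1 / 2)]
      gcongr
  have hlim : Tendsto (fun n : ℕ => (1 / 2 : ℝ) ^ n) atTop (𝓝 0) :=
    tendsto_pow_atTop_nhds_zero_of_lt_one (by norm_num) (by norm_num)
  refine Measure.ext fun A hA => ?_
  rw [Measure.map_apply measurable_transformation hA]
  have h := ge_of_tendsto' hlim fun n => key n A hA
  exact (measureReal_eq_measureReal_iff).1 (sub_eq_zero.1 (abs_nonpos_iff.1 h))

instance : StandardBorelSpace I01 := measurableSet_Ico.standardBorel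

/-! ### Composition operators -/

section Composition

variable {X : Type*} [MeasurableSpace X] {μ : Measure X}

/-- `A` is the operator of composition with `Φ`. -/
def IsComp (A : Lp ℂ 2 μ → Lp ℂ 2 μ) (Φ : X → X) : Prop :=
  ∀ f : Lp ℂ 2 μ, A f =ᵐ[μ] f ∘ Φ

namespace IsComp

theorem comp {A B : Lp ℂ 2 μ → Lp ℂ 2 μ} {Φ Ψ : X → X} (hA : IsComp A Φ) (hB : IsComp B Ψ)
    (hΦ : Measure.QuasiMeasurePreserving Φ μ μ) : IsComp (fun f => A (B f)) fun x => Ψ (Φ x) :=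
  fun f => (hA (B f)).trans (hΦ.ae_eq_comp (hB f))

theorem apply_eq {A B : Lp ℂ 2 μ → Lp ℂ 2 μ} {Φ Ψ : X → X} (hA : IsComp A Φ) (hB : IsComp B Ψ)
    (h : ∀ x, Φ x = Ψ x) (f : Lp ℂ 2 μ) : A f = B f := by
  obtain rfl : Φ = Ψ := funext h
  exact Lp.ext ((hA f).trans (hB f).symm)

theorem refl : IsComp (fun f : Lp ℂ 2 μ => f) fun x => x := fun _ => EventuallyEq.rfl

theorem toLp_eq {A : Lp ℂ 2 μ → Lp ℂ 2 μ} {Φ : X → X} (hA : IsComp A Φ)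
    (hΦ : Measure.QuasiMeasurePreserving Φ μ μ) {u v : X → ℂ} (hu : MemLp u 2 μ) (hv : MemLp v 2 μ)
    (h : ∀ x, u (Φ x) = v x) : A hu.toLp = hv.toLp := by
  refine Lp.ext ((hA _).trans ((hΦ.ae_eq_comp hu.coeFn_toLp).trans ?_))
  refine EventuallyEq.trans ?_ hv.coeFn_toLp.symm
  exact Eventually.of_forall h

end IsComp

/-- The unitary operator of composition with a measure-preserving map that has a
measure-preserving left inverse. -/
def compEquiv {Φ Ψ : X → X} (hΦ : MeasurePreserving Φ μ μ) (hΨ : MeasurePreserving Ψ μ μ)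
    (h : ∀ x, Ψ (Φ x) = x) : Lp ℂ 2 μ ≃ₗᵢ[ℂ] Lp ℂ 2 μ :=
  LinearIsometryEquiv.ofSurjective (Lp.compMeasurePreservingₗᵢ ℂ Φ hΦ) fun f =>
    ⟨Lp.compMeasurePreserving Ψ hΨ f, by
      refine Lp.ext ((Lp.coeFn_compMeasurePreserving _ hΦ).trans ?_)
      refine (hΦ.quasiMeasurePreserving.ae_eq_comp
        (Lp.coeFn_compMeasurePreserving f hΨ)).trans ?_
      exact Eventually.of_forall fun x => congrArg f (h x)⟩

theorem isComp_compEquiv {Φ Ψ : X → X} (hΦ : MeasurePreserving Φ μ μ)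
    (hΨ : MeasurePreserving Ψ μ μ) (h : ∀ x, Ψ (Φ x) = x) : IsComp (compEquiv hΦ hΨ h) Φ :=
  fun f => Lp.coeFn_compMeasurePreserving f hΦ

theorem eLpNorm_comp_le {Φ : X → X} (hΦ : Measurable Φ) {c : ENNReal} (hle : μ.map Φ ≤ c • μ)
    (f : Lp ℂ 2 μ) :
    eLpNorm (f ∘ Φ) 2 μ ≤ c ^ (1 / (2 : ENNReal)).toReal * eLpNorm f 2 μ := by
  have hac : μ.map Φ ≪ μ := Measure.absolutelyContinuous_of_le_smul hle
  rw [← eLpNorm_map_measure ((Lp.aestronglyMeasurable f).mono_ac hac) hΦ.aemeasurable]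
  exact (eLpNorm_mono_measure _ hle).trans
    (eLpNorm_smul_measure_of_ne_top (by norm_num) _ _).le

theorem quasiMeasurePreserving_of_map_le {Φ : X → X} (hΦ : Measurable Φ) {c : ENNReal}
    (hle : μ.map Φ ≤ c • μ) : Measure.QuasiMeasurePreserving Φ μ μ :=
  ⟨hΦ, Measure.absolutelyContinuous_of_le_smul hle⟩

theorem memLp_comp {Φ : X → X} (hΦ : Measurable Φ) {c : ENNReal} (hc : c ≠ ⊤)
    (hle : μ.map Φ ≤ c • μ) (f : Lp ℂ 2 μ) : MemLp (f ∘ Φ) 2 μ :=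
  ⟨(Lp.aestronglyMeasurable f).comp_quasiMeasurePreserving
    (quasiMeasurePreserving_of_map_le hΦ hle), (eLpNorm_comp_le hΦ hle f).trans_lt
      (ENNReal.mul_lt_top (ENNReal.rpow_ne_top_of_nonneg ENNReal.toReal_nonneg hc).lt_top
        (Lp.eLpNorm_lt_top f))⟩

/-- The bounded operator of composition with a map whose image measure is dominated by a multiple
of the measure. -/
def compCLM {Φ : X → X} (hΦ : Measurable Φ) {c : ENNReal} (hc : c ≠ ⊤) (hle : μ.map Φ ≤ c • μ) :
    Lp ℂ 2 μ →L[ℂ] Lp ℂ 2 μ :=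
  have hC : c ^ (1 / (2 : ENNReal)).toReal ≠ ⊤ :=
    ENNReal.rpow_ne_top_of_nonneg ENNReal.toReal_nonneg hc
  have hq := quasiMeasurePreserving_of_map_le hΦ hle
  have hmem := memLp_comp hΦ hc hle
  LinearMap.mkContinuous
    { toFun := fun f => (hmem f).toLp
      map_add' := fun f g => by
        rw [← MemLp.toLp_add]
        exact MemLp.toLp_congr _ _ (hq.ae_eq_comp (Lp.coeFn_add f g))
      map_smul' := fun a f => by
        rw [RingHom.id_apply, ← MemLp.toLp_const_smul]
        exact MemLp.toLp_congr _ _ (hq.ae_eq_comp (Lp.coeFn_smul a f)) }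
    (c ^ (1 / (2 : ENNReal)).toReal).toReal fun f => by
      change ‖(hmem f).toLp‖ ≤ _
      rw [Lp.norm_toLp, Lp.norm_def, ← ENNReal.toReal_mul]
      exact ENNReal.toReal_mono (ENNReal.mul_ne_top hC (Lp.eLpNorm_ne_top f))
        (eLpNorm_comp_le hΦ hle f)

theorem isComp_compCLM {Φ : X → X} (hΦ : Measurable Φ) {c : ENNReal} (hc : c ≠ ⊤)
    (hle : μ.map Φ ≤ c • μ) : IsComp (compCLM hΦ hc hle) Φ :=
  fun f => (memLp_comp hΦ hc hle f).coeFn_toLp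

end Composition

/-! ### The operators attached to the Mathew–Nadkarni transformation -/

theorem map_lowerProd_le : mnMeasure.map lowerProd ≤ (2 : ENNReal) • mnMeasure := by
  have h : (1 / 2 : ENNReal) • mnMeasure.map lowerProd ≤ mnMeasure := by
    conv_rhs => rw [mnMeasure_eq]
    exact Measure.le_add_right le_rfl
  calc mnMeasure.map lowerProd = (2 : ENNReal) • (1 / 2 : ENNReal) • mnMeasure.map lowerProd := by
        rw [smul_smul, one_div, ENNReal.mul_inv_cancel (by norm_num) (by norm_num), one_smul]
    _ ≤ _ := by gcongr

theorem map_upperProd_le : mnMeasure.map upperProd ≤ (2 : ENNReal) • mnMeasure := by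
  have h : (1 / 2 : ENNReal) • mnMeasure.map upperProd ≤ mnMeasure := by
    conv_rhs => rw [mnMeasure_eq]
    exact Measure.le_add_left le_rfl
  calc mnMeasure.map upperProd = (2 : ENNReal) • (1 / 2 : ENNReal) • mnMeasure.map upperProd := by
        rw [smul_smul, one_div, ENNReal.mul_inv_cancel (by norm_num) (by norm_num), one_smul]
    _ ≤ _ := by gcongr

theorem qmp_lowerProd : Measure.QuasiMeasurePreserving lowerProd mnMeasure mnMeasure :=
  quasiMeasurePreserving_of_map_le measurable_lowerProd map_lowerProd_le

theorem qmp_upperProd : Measure.QuasiMeasurePreserving upperProd mnMeasure mnMeasure :=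
  quasiMeasurePreserving_of_map_le measurable_upperProd map_upperProd_le

/-- In a standard Borel space an injective measurable map has measurable images, which supplies a
measurable inverse. -/
theorem measurableEmbedding_transformation : MeasurableEmbedding transformation :=
  measurable_transformation.measurableEmbedding transformation_injective

instance : Nonempty (I01 × ZMod 2) := ⟨(⟨0, by norm_num⟩, 0)⟩

/-- A measurable left inverse of the transformation. -/
def transformationInv : I01 × ZMod 2 → I01 × ZMod 2 :=
  measurableEmbedding_transformation.invFun

theorem transformationInv_transformation (p : I01 × ZMod 2) :
    transformationInv (transformation p) = p :=
  measurableEmbedding_transformation.leftInverse_invFun p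

theorem measurePreserving_transformationInv :
    MeasurePreserving transformationInv mnMeasure mnMeasure := by
  have hm : Measurable transformationInv := measurableEmbedding_transformation.measurable_invFun
  refine ⟨hm, ?_⟩
  conv_lhs => rw [← measurePreserving_transformation.map_eq]
  rw [Measure.map_map hm measurable_transformation]
  convert Measure.map_id
  exact funext transformationInv_transformation

/-- The operator `f ↦ f ∘ T` of the Mathew-Nadkarni transformation `T`, inverse to the Koopman
operator. -/
abbrev opV : Lp ℂ 2 mnMeasure ≃ₗᵢ[ℂ] Lp ℂ 2 mnMeasure :=
  compEquiv measurePreserving_transformation measurePreserving_transformationInv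
    transformationInv_transformation

/-- Composition with the translation of the fibres by the first digit. -/
abbrev opC : Lp ℂ 2 mnMeasure ≃ₗᵢ[ℂ] Lp ℂ 2 mnMeasure :=
  compEquiv measurePreserving_twist measurePreserving_twist twist_twist

/-- Composition with the translation of the fibres by `1`. -/
abbrev opJ : Lp ℂ 2 mnMeasure ≃ₗᵢ[ℂ] Lp ℂ 2 mnMeasure :=
  compEquiv measurePreserving_flip measurePreserving_flip flip_flip

/-- Restriction to the part where the first digit is `0`, rescaled. -/
abbrev opLower : Lp ℂ 2 mnMeasure →L[ℂ] Lp ℂ 2 mnMeasure :=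
  compCLM measurable_lowerProd (c := 2) (by norm_num) map_lowerProd_le

/-- Restriction to the part where the first digit is `1`, rescaled. -/
abbrev opUpper : Lp ℂ 2 mnMeasure →L[ℂ] Lp ℂ 2 mnMeasure :=
  compCLM measurable_upperProd (c := 2) (by norm_num) map_upperProd_le

theorem isComp_V : IsComp opV transformation := isComp_compEquiv _ _ _

theorem isComp_C : IsComp opC twist := isComp_compEquiv _ _ _

theorem isComp_J : IsComp opJ flip := isComp_compEquiv _ _ _

theorem isComp_lower : IsComp opLower lowerProd := isComp_compCLM _ _ _

theorem isComp_upper : IsComp opUpper upperProd := isComp_compCLM _ _ _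

theorem integral_mnMeasure {E : Type*} [NormedAddCommGroup E] [NormedSpace ℝ E]
    {u : I01 × ZMod 2 → E} (hu : Integrable u mnMeasure) :
    ∫ p, u p ∂mnMeasure = (1 / 2 : ℝ) • ∫ p, u (lowerProd p) ∂mnMeasure
      + (1 / 2 : ℝ) • ∫ p, u (upperProd p) ∂mnMeasure := by
  have hl : Integrable u (mnMeasure.map lowerProd) :=
    (hu.smul_measure (by norm_num)).mono_measure map_lowerProd_le
  have hr : Integrable u (mnMeasure.map upperProd) :=
    (hu.smul_measure (by norm_num)).mono_measure map_upperProd_le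
  conv_lhs => rw [mnMeasure_eq]
  rw [integral_add_measure (hl.smul_measure (by norm_num)) (hr.smul_measure (by norm_num)),
    integral_smul_measure, integral_smul_measure,
    integral_map measurable_lowerProd.aemeasurable hl.1,
    integral_map measurable_upperProd.aemeasurable hr.1]
  norm_num

theorem inner_eq_half (f g : Lp ℂ 2 mnMeasure) : inner ℂ f g
    = (1 / 2 : ℂ) * (inner ℂ (opLower f) (opLower g) + inner ℂ (opUpper f) (opUpper g)) := by
  rw [L2.inner_def, integral_mnMeasure (L2.integrable_inner f g), L2.inner_def, L2.inner_def]
  have h1 : ∫ p, inner ℂ (opLower f p) (opLower g p) ∂mnMeasure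
      = ∫ p, inner ℂ (f (lowerProd p)) (g (lowerProd p)) ∂mnMeasure := by
    refine integral_congr_ae ?_
    filter_upwards [isComp_lower f, isComp_lower g] with p hf hg
    rw [hf, hg, Function.comp_apply, Function.comp_apply]
  have h2 : ∫ p, inner ℂ (opUpper f p) (opUpper g p) ∂mnMeasure
      = ∫ p, inner ℂ (f (upperProd p)) (g (upperProd p)) ∂mnMeasure := by
    refine integral_congr_ae ?_
    filter_upwards [isComp_upper f, isComp_upper g] with p hf hg
    rw [hf, hg, Function.comp_apply, Function.comp_apply]
  rw [h1, h2, Complex.real_smul, Complex.real_smul]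
  push_cast
  ring

/-- The nontrivial character of the fibre. -/
def sign (p : I01 × ZMod 2) : ℂ := if p.2 = 0 then 1 else -1

theorem measurable_sign : Measurable sign :=
  (measurable_from_top (f := fun g : ZMod 2 => if g = 0 then (1 : ℂ) else -1)).comp measurable_snd

theorem norm_sign (p : I01 × ZMod 2) : ‖sign p‖ = 1 := by
  unfold sign; split_ifs <;> simp

theorem memLp_sign : MemLp sign 2 mnMeasure :=
  MemLp.of_bound measurable_sign.aestronglyMeasurable 1
    (Eventually.of_forall fun p => (norm_sign p).le)

theorem memLp_one : MemLp (fun _ => (1 : ℂ)) 2 mnMeasure := memLp_const 1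

theorem sign_flip (p : I01 × ZMod 2) : sign (flip p) = -sign p := by
  obtain ⟨x, g⟩ := p
  have : g = 0 ∨ g = 1 := by revert g; decide
  rcases this with rfl | rfl
  · simp [sign, flip]
  · simp [sign, flip, show (1 + 1 : ZMod 2) = 0 from rfl]

/-! ### Functions determined by the cylinders -/

/-- The part of the fibre over `[0, a)` with second coordinate `g`. -/
def strip (a : ℝ) (g : ZMod 2) : Set (I01 × ZMod 2) := {p | (p.1 : ℝ) < a ∧ p.2 = g}

theorem measurableSet_strip (a : ℝ) (g : ZMod 2) : MeasurableSet (strip a g) :=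
  (measurableSet_lt (measurable_subtype_coe.comp measurable_fst) measurable_const).inter
    (measurable_snd (measurableSet_singleton g))

theorem lowerProd_preimage_strip (a : ℝ) (g : ZMod 2) :
    lowerProd ⁻¹' strip a g = strip (2 * a) g := by
  ext ⟨x, h⟩
  refine and_congr ?_ Iff.rfl
  change (x : ℝ) / 2 < a ↔ (x : ℝ) < 2 * a
  constructor <;> intro h <;> linarith

theorem upperProd_preimage_strip (a : ℝ) (g : ZMod 2) :
    upperProd ⁻¹' strip a g = strip (2 * a - 1) g := by
  ext ⟨x, h⟩
  refine and_congr ?_ Iff.rfl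
  change ((x : ℝ) + 1) / 2 < a ↔ (x : ℝ) < 2 * a - 1
  constructor <;> intro h <;> linarith

theorem strip_of_nonpos {a : ℝ} (ha : a ≤ 0) (g : ZMod 2) : strip a g = ∅ := by
  ext ⟨x, h⟩
  simp only [strip, Set.mem_ofPred_eq, Set.mem_empty_iff_false, iff_false, not_and]
  intro hx
  have := x.2.1
  linarith

theorem strip_of_one_le {a : ℝ} (ha : 1 ≤ a) (g : ZMod 2) :
    strip a g = Prod.snd ⁻¹' {g} := by
  ext ⟨x, h⟩
  simp only [strip, Set.mem_ofPred_eq, Set.mem_preimage, Set.mem_singleton_iff,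
    and_iff_right_iff_imp]
  intro _
  have := x.2.2
  linarith

theorem integrable_Lp (f : Lp ℂ 2 mnMeasure) : Integrable f mnMeasure :=
  (Lp.memLp f).integrable (by norm_num)

theorem setIntegral_eq_half (f : Lp ℂ 2 mnMeasure) {s : Set (I01 × ZMod 2)} (hs : MeasurableSet s) :
    ∫ p in s, f p ∂mnMeasure = (1 / 2 : ℝ) • ∫ p in lowerProd ⁻¹' s, opLower f p ∂mnMeasure
      + (1 / 2 : ℝ) • ∫ p in upperProd ⁻¹' s, opUpper f p ∂mnMeasure := by
  rw [← integral_indicator hs, integral_mnMeasure ((integrable_Lp f).indicator hs),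
    ← integral_indicator (measurable_lowerProd hs), ← integral_indicator (measurable_upperProd hs)]
  congr 2
  · refine integral_congr_ae ?_
    filter_upwards [isComp_lower f] with p hp
    simp only [Set.indicator, hp, Function.comp_apply]
    rfl
  · refine integral_congr_ae ?_
    filter_upwards [isComp_upper f] with p hp
    simp only [Set.indicator, hp, Function.comp_apply]
    rfl

theorem norm_setIntegral_le_norm (f : Lp ℂ 2 mnMeasure) {s : Set (I01 × ZMod 2)}
    (hs : MeasurableSet s) : ‖∫ p in s, f p ∂mnMeasure‖ ≤ ‖f‖ := by
  rw [← L2.inner_indicatorConstLp_one hs (measure_ne_top _ _)]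
  refine (norm_inner_le_norm _ _).trans (mul_le_of_le_one_left (norm_nonneg _) ?_)
  rw [norm_indicatorConstLp (by norm_num) (by norm_num), norm_one, one_mul]
  exact Real.rpow_le_one measureReal_nonneg measureReal_le_one (by norm_num)

theorem norm_sq_eq_half (f : Lp ℂ 2 mnMeasure) :
    ‖f‖ ^ 2 = (1 / 2) * (‖opLower f‖ ^ 2 + ‖opUpper f‖ ^ 2) := by
  have h := inner_eq_half f f
  rw [inner_self_eq_norm_sq_to_K, inner_self_eq_norm_sq_to_K, inner_self_eq_norm_sq_to_K] at h
  have h' : ((‖f‖ ^ 2 : ℝ) : ℂ) = (((1 / 2) * (‖opLower f‖ ^ 2 + ‖opUpper f‖ ^ 2) : ℝ) : ℂ) := by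
    push_cast
    exact h
  exact_mod_cast h'

theorem norm_opLower_le (f : Lp ℂ 2 mnMeasure) : ‖opLower f‖ ≤ √2 * ‖f‖ := by
  refine abs_le_of_sq_le_sq' ?_ (by positivity) |>.2
  rw [mul_pow, Real.sq_sqrt (by norm_num), norm_sq_eq_half f]
  nlinarith [sq_nonneg ‖opUpper f‖]

theorem norm_opUpper_le (f : Lp ℂ 2 mnMeasure) : ‖opUpper f‖ ≤ √2 * ‖f‖ := by
  refine abs_le_of_sq_le_sq' ?_ (by positivity) |>.2
  rw [mul_pow, Real.sq_sqrt (by norm_num), norm_sq_eq_half f]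
  nlinarith [sq_nonneg ‖opLower f‖]

/-- Of the two halves of a strip, one is empty or a full fibre and contributes nothing; the other is
again a strip. Each step multiplies the bound by `1 / 2`, while the restriction raises the norm by
at most `√2`, leaving the factor `√2 / 2 < 1`. -/
theorem setIntegral_strip_eq_zero {K : Set (Lp ℂ 2 mnMeasure)}
    (hl : ∀ f ∈ K, opLower f ∈ K) (hu : ∀ f ∈ K, opUpper f ∈ K)
    (hK : ∀ f ∈ K, ∀ g : ZMod 2, ∫ p in Prod.snd ⁻¹' {g}, f p ∂mnMeasure = 0)
    {f : Lp ℂ 2 mnMeasure} (hf : f ∈ K) (a : ℝ) (g : ZMod 2) :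
    ∫ p in strip a g, f p ∂mnMeasure = 0 := by
  have key : ∀ (n : ℕ), ∀ f ∈ K, ∀ a : ℝ,
      ‖∫ p in strip a g, f p ∂mnMeasure‖ ≤ (√2 / 2) ^ n * ‖f‖ := by
    intro n
    induction n with
    | zero =>
      intro f _ a
      simpa using norm_setIntegral_le_norm f (measurableSet_strip a g)
    | succ n ih =>
      intro f hf a
      rw [setIntegral_eq_half f (measurableSet_strip a g), lowerProd_preimage_strip,
        upperProd_preimage_strip]
      rcases le_total a (1 / 2) with ha | ha
      · rw [strip_of_nonpos (by linarith : 2 * a - 1 ≤ 0), setIntegral_empty, smul_zero, add_zero,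
          norm_smul]
        calc ‖(1 / 2 : ℝ)‖ * ‖∫ p in strip (2 * a) g, opLower f p ∂mnMeasure‖
            ≤ (1 / 2) * ((√2 / 2) ^ n * (√2 * ‖f‖)) := by
              rw [Real.norm_of_nonneg (by norm_num)]
              have := (ih _ (hl f hf) (2 * a)).trans
                (mul_le_mul_of_nonneg_left (norm_opLower_le f) (by positivity))
              linarith
          _ = _ := by ring
      · rw [strip_of_one_le (by linarith : 1 ≤ 2 * a), hK _ (hl f hf), smul_zero, zero_add,
          norm_smul]
        calc ‖(1 / 2 : ℝ)‖ * ‖∫ p in strip (2 * a - 1) g, opUpper f p ∂mnMeasure‖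
            ≤ (1 / 2) * ((√2 / 2) ^ n * (√2 * ‖f‖)) := by
              rw [Real.norm_of_nonneg (by norm_num)]
              have := (ih _ (hu f hf) (2 * a - 1)).trans
                (mul_le_mul_of_nonneg_left (norm_opUpper_le f) (by positivity))
              linarith
          _ = _ := by ring
  have hlt : √2 / 2 < 1 := by
    have : √2 < 2 := by rw [Real.sqrt_lt' (by norm_num)]; norm_num
    linarith
  have hlim : Tendsto (fun n : ℕ => (√2 / 2) ^ n * ‖f‖) atTop (𝓝 0) := by
    have := (tendsto_pow_atTop_nhds_zero_of_lt_one (by positivity) hlt).mul_const ‖f‖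
    rwa [zero_mul] at this
  exact norm_le_zero_iff.1 (ge_of_tendsto' hlim fun n => key n f hf a)

/-- Initial intervals form a π-system generating the Borel sets of `[0, 1)`, so vanishing on strips
spreads to all measurable subsets of each of the two fibres. -/
theorem eq_zero_of_mem {K : Set (Lp ℂ 2 mnMeasure)}
    (hl : ∀ f ∈ K, opLower f ∈ K) (hu : ∀ f ∈ K, opUpper f ∈ K)
    (hK : ∀ f ∈ K, ∀ g : ZMod 2, ∫ p in Prod.snd ⁻¹' {g}, f p ∂mnMeasure = 0)
    {f : Lp ℂ 2 mnMeasure} (hf : f ∈ K) : f = 0 := by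
  have hstrip := setIntegral_strip_eq_zero hl hu hK hf
  have hi := integrable_Lp f
  have hprod : ∀ g : ZMod 2, ∀ A : Set I01, MeasurableSet A →
      ∫ p in Prod.fst ⁻¹' A ∩ Prod.snd ⁻¹' {g}, f p ∂mnMeasure = 0 := by
    intro g A hA
    have hg : MeasurableSet (Prod.snd ⁻¹' {g} : Set (I01 × ZMod 2)) :=
      measurable_snd (measurableSet_singleton g)
    induction A, hA using MeasurableSpace.induction_on_inter
      (BorelSpace.measurable_eq.trans (borel_eq_generateFrom_Iio I01)) isPiSystem_Iio with
    | empty => simp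
    | basic t ht =>
      obtain ⟨a, rfl⟩ := ht
      exact hstrip a g
    | compl t ht ih =>
      have h1 : (Prod.fst ⁻¹' tᶜ ∩ Prod.snd ⁻¹' {g} : Set (I01 × ZMod 2))
          = Prod.snd ⁻¹' {g} \ (Prod.fst ⁻¹' t ∩ Prod.snd ⁻¹' {g}) := by
        ext p; simp; tauto
      rw [h1, setIntegral_sdiff ((measurable_fst ht).inter hg) hi.integrableOn
        Set.inter_subset_right, ih, hK f hf, sub_zero]
    | iUnion t hd ht ih =>
      rw [Set.preimage_iUnion, Set.iUnion_inter, integral_iUnion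
        (fun i => (measurable_fst (ht i)).inter hg) ?_ hi.integrableOn]
      · simp [ih]
      · intro i j hij
        exact ((hd hij).preimage Prod.fst).mono Set.inter_subset_left Set.inter_subset_left
  have hae : f =ᵐ[mnMeasure] 0 := by
    refine Integrable.ae_eq_zero_of_forall_setIntegral_eq_zero hi fun s hs _ => ?_
    have hg : ∀ g, MeasurableSet (Prod.snd ⁻¹' {g} : Set (I01 × ZMod 2)) := fun g =>
      measurable_snd (measurableSet_singleton g)
    have hsg : ∀ g, ∫ p in s ∩ Prod.snd ⁻¹' {g}, f p ∂mnMeasure = 0 := by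
      intro g
      have h1 : s ∩ Prod.snd ⁻¹' {g}
          = Prod.fst ⁻¹' ((fun x => (x, g)) ⁻¹' s) ∩ Prod.snd ⁻¹' {g} := by
        ext ⟨x, h⟩
        simp only [Set.mem_inter_iff, Set.mem_preimage, Set.mem_singleton_iff]
        constructor <;> rintro ⟨h1, rfl⟩ <;> exact ⟨h1, rfl⟩
      rw [h1]
      exact hprod g _ (measurable_prodMk_right hs)
    rw [← integral_inter_add_sdiff (hg 0) hi.integrableOn, hsg 0, zero_add]
    have h2 : s \ Prod.snd ⁻¹' {(0 : ZMod 2)} = s ∩ Prod.snd ⁻¹' {1} := by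
      ext ⟨x, h⟩
      have : h ≠ 0 ↔ h = 1 := by revert h; decide
      simp [this]
    rw [h2, hsg 1]
  exact (Lp.eq_zero_iff_ae_eq_zero).2 hae

theorem inner_toLp_eq {u : I01 × ZMod 2 → ℂ} (hu : MemLp u 2 mnMeasure) (f : Lp ℂ 2 mnMeasure) :
    inner ℂ hu.toLp f = ∫ p, f p * (starRingEnd ℂ) (u p) ∂mnMeasure := by
  rw [L2.inner_def]
  refine integral_congr_ae ?_
  filter_upwards [hu.coeFn_toLp] with p hp
  rw [hp, RCLike.inner_apply]

theorem setIntegral_fibre_eq_zero {f : Lp ℂ 2 mnMeasure} (h1 : inner ℂ memLp_one.toLp f = 0)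
    (h2 : inner ℂ memLp_sign.toLp f = 0) (g : ZMod 2) :
    ∫ p in Prod.snd ⁻¹' {g}, f p ∂mnMeasure = 0 := by
  have hi := integrable_Lp f
  have hg : MeasurableSet (Prod.snd ⁻¹' {g} : Set (I01 × ZMod 2)) :=
    measurable_snd (measurableSet_singleton g)
  rw [inner_toLp_eq] at h1 h2
  have his : Integrable (fun p => f p * (starRingEnd ℂ) (sign p)) mnMeasure := by
    refine hi.mul_bdd (c := 1) (Complex.continuous_conj.measurable.comp
      measurable_sign).aestronglyMeasurable (Eventually.of_forall fun p => ?_)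
    rw [RCLike.norm_conj, norm_sign]
  have hi1 : Integrable (fun p => f p * (starRingEnd ℂ) (1 : ℂ)) mnMeasure := by simpa using hi
  set s : ℂ := if g = 0 then 1 else -1 with hs
  -- The indicator of a fibre value is a combination of the two characters of `ℤ/2`.
  have h3 : ∀ p, (Prod.snd ⁻¹' {g} : Set (I01 × ZMod 2)).indicator f p = (1 / 2 : ℂ) *
      (f p * (starRingEnd ℂ) (1 : ℂ) + s * (f p * (starRingEnd ℂ) (sign p))) := by
    rintro ⟨x, h⟩
    have hg' : g = 0 ∨ g = 1 := by clear * -; revert g; decide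
    have hh' : h = 0 ∨ h = 1 := by clear * -; revert h; decide
    rcases hg' with rfl | rfl <;> rcases hh' with rfl | rfl <;>
      simp [hs, sign] <;> ring
  rw [← integral_indicator hg]
  simp_rw [h3]
  rw [integral_const_mul, integral_add hi1 (his.const_mul s), integral_const_mul, h1, h2]
  simp

/-- The self-similar unitary operator given by the Mathew-Nadkarni transformation. -/
def system : SelfSimilarUnitary (Lp ℂ 2 mnMeasure) where
  U := opV.symm
  C := opC
  J := opJ
  R₀ := opLower
  R₁ := opUpper
  e := memLp_one.toLp
  F := memLp_sign.toLp
  R₀_U f := by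
    -- Since `U` is inverse to composition with the transformation, writing `f = opV g` and, where
    -- `U` remains, applying `opV` reduces each relation to a pointwise identity of maps.
    obtain ⟨g, rfl⟩ := opV.surjective f
    apply opV.injective
    rw [opV.symm_apply_apply, opV.apply_symm_apply]
    exact (isComp_V.comp isComp_lower
      measurePreserving_transformation.quasiMeasurePreserving).apply_eq
      (isComp_upper.comp isComp_V qmp_upperProd) (fun p => (transformation_upperProd p).symm) g
  R₁_U f := by
    obtain ⟨g, rfl⟩ := opV.surjective f
    rw [opV.symm_apply_apply]
    exact isComp_upper.apply_eq (isComp_C.comp (isComp_lower.comp isComp_V qmp_lowerProd)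
      measurePreserving_twist.quasiMeasurePreserving)
      (fun p => by rw [transformation_lowerProd, twist_twist]) g
  C_U f := by
    obtain ⟨g, rfl⟩ := opV.surjective f
    apply opV.injective
    rw [opV.symm_apply_apply, opV.apply_symm_apply]
    exact (isComp_V.comp isComp_C measurePreserving_transformation.quasiMeasurePreserving).apply_eq
      (isComp_C.comp (isComp_J.comp isComp_V measurePreserving_flip.quasiMeasurePreserving)
        measurePreserving_twist.quasiMeasurePreserving)
      (fun p => by rw [twist_transformation, transformation_flip]) g
  C_C := (isComp_C.comp isComp_C measurePreserving_twist.quasiMeasurePreserving).apply_eq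
    IsComp.refl twist_twist
  J_J := (isComp_J.comp isComp_J measurePreserving_flip.quasiMeasurePreserving).apply_eq
    IsComp.refl flip_flip
  J_U f := by
    obtain ⟨g, rfl⟩ := opV.surjective f
    apply opV.injective
    rw [opV.symm_apply_apply, opV.apply_symm_apply]
    exact (isComp_V.comp isComp_J measurePreserving_transformation.quasiMeasurePreserving).apply_eq
      (isComp_J.comp isComp_V measurePreserving_flip.quasiMeasurePreserving)
      (fun p => (transformation_flip p).symm) g
  J_C := (isComp_J.comp isComp_C measurePreserving_flip.quasiMeasurePreserving).apply_eq
    (isComp_C.comp isComp_J measurePreserving_twist.quasiMeasurePreserving) twist_flip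
  R₀_J := (isComp_lower.comp isComp_J qmp_lowerProd).apply_eq
    (isComp_J.comp isComp_lower measurePreserving_flip.quasiMeasurePreserving) fun _ => rfl
  R₁_J := (isComp_upper.comp isComp_J qmp_upperProd).apply_eq
    (isComp_J.comp isComp_upper measurePreserving_flip.quasiMeasurePreserving) fun _ => rfl
  R₀_C := (isComp_lower.comp isComp_C qmp_lowerProd).apply_eq isComp_lower twist_lowerProd
  R₁_C := (isComp_upper.comp isComp_C qmp_upperProd).apply_eq
    (isComp_upper.comp isComp_J qmp_upperProd) twist_upperProd
  C_of_J f hf := by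
    refine Lp.ext ?_
    filter_upwards [isComp_C f, (isComp_J f).symm.trans (by rw [hf])] with p hp1 hp2
    rw [hp1, Function.comp_apply]
    rcases twist_eq_or p with h | h
    · rw [h]
    · rw [h]; exact hp2
  inner_eq := inner_eq_half
  R₀_F := isComp_lower.toLp_eq qmp_lowerProd _ _ fun _ => rfl
  R₁_F := isComp_upper.toLp_eq qmp_upperProd _ _ fun _ => rfl
  J_F := by
    rw [← MemLp.toLp_neg]
    exact isComp_J.toLp_eq measurePreserving_flip.quasiMeasurePreserving _ _ sign_flip
  norm_F := by
    rw [Lp.norm_toLp, eLpNorm_congr_norm_ae (g := fun _ => (1 : ℂ))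
      (Eventually.of_forall fun p => by rw [norm_sign, norm_one]), eLpNorm_const _ (by norm_num)
      (IsProbabilityMeasure.ne_zero _)]
    simp
  J_e := isComp_J.toLp_eq measurePreserving_flip.quasiMeasurePreserving _ _ fun _ => rfl
  U_e := by
    rw [LinearIsometryEquiv.symm_apply_eq]
    exact (isComp_V.toLp_eq measurePreserving_transformation.quasiMeasurePreserving memLp_one
      memLp_one fun _ => rfl).symm
  norm_e := by
    rw [Lp.norm_toLp, eLpNorm_const _ (by norm_num) (IsProbabilityMeasure.ne_zero _)]
    simp
  eq_zero K hl hu he hF f hf :=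
    eq_zero_of_mem hl hu (fun f hf => setIntegral_fibre_eq_zero (he f hf) (hF f hf)) hf

/-! ### Rigidity and spectrum of the transformation -/

theorem isKoopman_system : IsKoopman transformation system.U := by
  intro f
  have h := isComp_V (opV.symm f)
  rw [opV.apply_symm_apply] at h
  exact h.symm

theorem isComp_V_pow (n : ℕ) : IsComp (opV ^ n) transformation^[n] := by
  induction n with
  | zero => exact IsComp.refl
  | succ n ih =>
    have := isComp_V.comp ih measurePreserving_transformation.quasiMeasurePreserving
    rw [pow_succ']
    exact this

theorem IsComp.indicatorConstLp_eq {X : Type*} [MeasurableSpace X] {μ : Measure X}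
    [IsFiniteMeasure μ] {B : Lp ℂ 2 μ → Lp ℂ 2 μ} {Φ : X → X} (hB : IsComp B Φ)
    (hΦ : MeasurePreserving Φ μ μ) {A : Set X} (hA : MeasurableSet A) :
    B (indicatorConstLp 2 hA (measure_ne_top μ A) 1)
      = indicatorConstLp 2 (hΦ.measurable hA) (measure_ne_top μ _) 1 := by
  refine Lp.ext ((hB _).trans ((hΦ.quasiMeasurePreserving.ae_eq_comp indicatorConstLp_coeFn).trans
    (EventuallyEq.trans ?_ indicatorConstLp_coeFn.symm)))
  exact Eventually.of_forall fun x => rfl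

theorem inner_U_pow (A : Set (I01 × ZMod 2)) (hA : MeasurableSet A) (n : ℕ) :
    inner ℂ (indicatorConstLp 2 hA (measure_ne_top mnMeasure A) (1 : ℂ))
      ((system.U ^ n) (indicatorConstLp 2 hA (measure_ne_top mnMeasure A) (1 : ℂ)))
      = (mnMeasure.real ((transformation^[n] '' A) ∩ A) : ℂ) := by
  set f := indicatorConstLp 2 hA (measure_ne_top mnMeasure A) (1 : ℂ) with hf
  have hT := measurePreserving_transformation.iterate n
  have hinj := transformation_injective.iterate n
  have h1 : inner ℂ f ((system.U ^ n) f) = inner ℂ ((opV ^ n) f) f := by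
    rw [← LinearIsometryEquiv.inner_map_map (opV ^ n) f, ← isometryEquiv_mul_apply]
    have : opV ^ n * system.U ^ n = 1 := by
      change opV ^ n * (opV⁻¹) ^ n = 1
      rw [inv_pow, mul_inv_cancel]
    rw [this]
    rfl
  have himage : MeasurableSet (transformation^[n] '' A) :=
    (hT.measurable.measurableEmbedding hinj).measurableSet_image.2 hA
  -- The operator side yields the preimage of `A`; invariance of the measure and injectivity of the
  -- iterate exchange it for the image.
  rw [h1, (isComp_V_pow n).indicatorConstLp_eq hT hA, hf,
    L2.inner_indicatorConstLp_one_indicatorConstLp_one]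
  rw [← hT.measureReal_preimage (himage.inter hA).nullMeasurableSet, Set.preimage_inter,
    hinj.preimage_image, Set.inter_comm]
  rfl

theorem isAlphaRigid_transformation : IsAlphaRigid transformation mnMeasure (1 / 2) := by
  refine ⟨by norm_num, by norm_num, fun k => 2 ^ k, pow_right_strictMono₀ one_lt_two,
    fun A hA => ?_⟩
  set f := indicatorConstLp 2 hA (measure_ne_top mnMeasure A) (1 : ℂ) with hf
  have h := Complex.continuous_re.continuousAt.tendsto.comp (system.tendsto_inner_pow f f)
  refine ⟨_, h.congr fun k => ?_, ?_⟩
  · rw [Function.comp_apply, inner_U_pow A hA, Complex.ofReal_re]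
  -- The limit is half of `μ A + μ (A ∩ flip⁻¹ A)`, and the second term is nonnegative.
  · have hJ : system.J f = _ := isComp_J.indicatorConstLp_eq measurePreserving_flip hA
    rw [inner_smul_right, inner_add_right, hJ, hf,
      L2.inner_indicatorConstLp_one_indicatorConstLp_one,
      L2.inner_indicatorConstLp_one_indicatorConstLp_one, Set.inter_self]
    have h0 := measureReal_nonneg (μ := mnMeasure) (s := A ∩ flip ⁻¹' A)
    have h2 : ((1 / 2 : ℂ) * ((mnMeasure.real A : ℂ) + (mnMeasure.real (A ∩ flip ⁻¹' A) : ℂ))).re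
        = (1 / 2) * (mnMeasure.real A + mnMeasure.real (A ∩ flip ⁻¹' A)) := by
      rw [← Complex.ofReal_re ((1 / 2) * (mnMeasure.real A + mnMeasure.real (A ∩ flip ⁻¹' A)))]
      push_cast
      rfl
    refine le_trans ?_ h2.ge
    linarith

theorem inner_e_eq_integral (f : Lp ℂ 2 mnMeasure) :
    inner ℂ system.e f = ∫ p, f p ∂mnMeasure := by
  refine (inner_toLp_eq memLp_one f).trans ?_
  simp

theorem exists_isReducedMaximalSpectralType :
    ∃ σ : Measure UnitAddCircle, IsReducedMaximalSpectralType system.U σ := by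
  obtain ⟨σ, h1, h2, h3⟩ := system.exists_maximalSpectralType
  simp_rw [inner_e_eq_integral] at h2 h3
  exact ⟨σ, h1, h2, h3⟩

/-- The generator `F` has mean zero and Lebesgue spectral measure, so a singular maximal type would
make Lebesgue measure singular to itself. -/
theorem not_hasSingularSpectrum : ¬ HasSingularSpectrum system.U := by
  rintro ⟨σ, ⟨-, h, -⟩, hs⟩
  have h1 : (volume : Measure UnitAddCircle) ≪ σ :=
    h (system.gen 0) (by rw [← inner_e_eq_integral, system.inner_e_gen]) _
      (isSpectralMeasure_volume (system.orthonormal_gen 0))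
  have h2 : (volume : Measure UnitAddCircle) ⟂ₘ volume :=
    hs.mono_ac h1 Measure.AbsolutelyContinuous.rfl
  rw [Measure.MutuallySingular.self_iff] at h2
  exact NeZero.ne _ h2

end MathewNadkarni

end

open MathewNadkarni in
theorem mainTheorem3 :
    IsProbabilityMeasure mnMeasure ∧
    MeasurePreserving transformation mnMeasure mnMeasure ∧
    IsAlphaRigid transformation mnMeasure (1 / 2) ∧
    (∃ U : Lp ℂ 2 mnMeasure ≃ₗᵢ[ℂ] Lp ℂ 2 mnMeasure,
      IsKoopman transformation U ∧
      HasLebesgueSpectrumOn U (discretePart U)ᗮ 2 ∧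
      (∃ σ : Measure UnitAddCircle, IsReducedMaximalSpectralType U σ) ∧
      ¬ HasSingularSpectrum U) ∧
    (∀ α : ℝ, 0 < α → α ≤ 1 / 2 → ¬ RigidityForcesSingularSpectrum α) := by
  refine ⟨inferInstance, measurePreserving_transformation, isAlphaRigid_transformation,
    ⟨system.U, isKoopman_system, system.hasLebesgueSpectrumOn,
      exists_isReducedMaximalSpectralType, not_hasSingularSpectrum⟩, fun α h0 hα h => ?_⟩
  -- One transformation refutes every `α ≤ 1 / 2`: the same times serve, as the lower bound only
  -- weakens.
  refine not_hasSingularSpectrum (h _ mnMeasure transformation system.U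
    measurePreserving_transformation isKoopman_system ⟨h0, by linarith, ?_⟩)
  obtain ⟨-, -, n, hn, hA⟩ := isAlphaRigid_transformation
  refine ⟨n, hn, fun A hAm => ?_⟩
  obtain ⟨l, hl, hle⟩ := hA A hAm
  exact ⟨l, hl, (mul_le_mul_of_nonneg_right hα measureReal_nonneg).trans hle⟩
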